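/- Let $F$ be an arbitrary field (any characteristic) and let $A$ be a unital composition algebra (Hurwitz algebra) over $F$: a nonzero, not necessarily associative $F$-algebra with unit $e$ and a quadratic form $n$ such that $n(ab)=n(a)n(b)$ for all $a,b$ and the polar form $n(a,b)=n(a+b)-n(a)-n(b)$ is nondegenerate. Put $\bar a=n(a,e)e-a$. The standard composition algebra $A^*=(A,*)$ of type I, II, III, IV is the vector space $A$ with the product $$\text{(I) } a*b=ab,\quad \text{(II) } a*b=\bar a b,\quad \text{(III) } a*b=a\bar b,\quad \text{(IV) } a*b=\bar a\bar b .$$ For a (possibly non-unital, non-associative) algebra $B$ and $S\subseteq B$, a word of length $k\ge 1$ in $S$ is a product of $k$ elements of $S$ with any arrangement of brackets; the unit element of $B$, if it exists, is the only word of length $0$. Let $\mathrm{Lin}_k(S)$ be the linear span of all words in $S$ of length at most $k$ and $\mathrm{Lin}_\infty(S)=\bigcup_k\mathrm{Lin}_k(S)$. The length of $S$ is $l(S)=\min\{k:\mathrm{Lin}_k(S)=\mathrm{Lin}_\infty(S)\}$, and the length of $B$ is $l(B)=\max\{l(S): \mathrm{Lin}_\infty(S)=B\}$. For $\mu\in F$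 let $K(\mu)=F+F\ell$ be the two-dimensional commutative associative unital algebra with $\ell^2=\ell+\mu$. **Theorem.** $A$ is finite-dimensional, and for every standard composition algebra $A^*$ built from $A$: 1. If $A^*$ is of type I, or $\dim A=1$ (in which case $A^*=A$ for all four types), then $l(A^*)=\log_2(\dim A^*)$. 2. If $F=\mathbb F_2$, $A\cong K(0)$, and $A^*$ is of type II or III, then $l(A^*)=1$. 3. If $F=\mathbb F_2$, $A\cong K(1)$, and $A^*$ is of type IV, then $l(A^*)=1$. 4. In all other cases, $l(A^*)=\max\{2,\log_2(\dim A^*)\}$. -/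

import Mathlib

/-! Unital composition algebras, standard composition algebras, and the length function of a
possibly non-unital, possibly non-associative algebra. -/

noncomputable section

namespace CompositionAlgebra

/-- `n` is a norm making `A` a composition algebra: its polar form
`n(a, b) = n(a + b) - n(a) - n(b)` is nondegenerate and `n` permits composition. -/
structure IsCompositionNorm {F A : Type*} [Field F] [NonAssocRing A] [Module F A]
    (n : QuadraticForm F A) : Prop where
  nondegenerate : n.polarBilin.Nondegenerate
  map_mul : ∀ a b : A, n (a * b) = n a * n b

/-- The involution `ā = n(a, e) e - a`, where `e = 1` is the unit element. -/
def conj {F A : Type*} [Field F] [NonAssocRing A] [Module F A]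
    (n : QuadraticForm F A) : A →ₗ[F] A :=
  (n.polarBilin.flip 1).smulRight (1 : A) - LinearMap.id

/-- The four types of standard composition algebras. -/
inductive StandardType : Type
  | I
  | II
  | III
  | IV

/-- The multiplication `*` of the standard composition algebra `A* = (A, *)` of the given type:
`ab`, `āb`, `ab̄`, `āb̄`, respectively. -/
def standardMul {F A : Type*} [Field F] [NonAssocRing A] [Module F A]
    [IsScalarTower F A A] [SMulCommClass F A A] (n : QuadraticForm F A) :
    StandardType → (A →ₗ[F] A →ₗ[F] A)
  | .I => LinearMap.mul F A
  | .II => (LinearMap.mul F A).compl₁₂ (conj n) LinearMap.id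
  | .III => (LinearMap.mul F A).compl₁₂ LinearMap.id (conj n)
  | .IV => (LinearMap.mul F A).compl₁₂ (conj n) (conj n)

/-- `A` is isomorphic, as an `F`-algebra, to `K(μ) = F + F ℓ` with `ℓ ^ 2 = ℓ + μ`. Here
`QuadraticAlgebra F μ 1` consists of the `x + y ω` with `ω ^ 2 = μ + 1 • ω`. -/
def IsK {F : Type*} [Field F] (A : Type*) [NonAssocRing A] [Module F A] (μ : F) : Prop :=
  ∃ φ : A ≃ₗ[F] QuadraticAlgebra F μ 1, ∀ a b : A, φ (a * b) = φ a * φ b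

section Length

/- In this section the algebra is the vector space `A` with the bilinear product `m`. -/

variable {F A : Type*} [Field F] [AddCommGroup A] [Module F A]

/-- `e` is a two-sided unit element of the algebra `(A, m)`. -/
def IsUnitElement (m : A →ₗ[F] A →ₗ[F] A) (e : A) : Prop :=
  ∀ a : A, m e a = a ∧ m a e = a

/-- `IsWord m S k w`: `w` is a product, in some arrangement of brackets, of `k ≥ 1` elements of
`S`. -/
inductive IsWord (m : A →ₗ[F] A →ₗ[F] A) (S : Set A) : ℕ → A → Prop
  | letter {a : A} : a ∈ S → IsWord m S 1 a
  | mul {j k : ℕ} {a b : A} : IsWord m S j a → IsWord m S k b → IsWord m S (j + k) (m a b)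

/-- The words in `S` of length at most `k`; the unit element, if there is one, is a word of
length `0`, and there are no other words of length `0`. -/
def words (m : A →ₗ[F] A →ₗ[F] A) (S : Set A) (k : ℕ) : Set A :=
  {w | IsUnitElement m w ∨ ∃ j ≤ k, IsWord m S j w}

/-- `Lin_k(S)`. -/
def lin (m : A →ₗ[F] A →ₗ[F] A) (S : Set A) (k : ℕ) : Submodule F A :=
  Submodule.span F (words m S k)

/-- `Lin_∞(S)`, the union of the increasing chain of the `Lin_k(S)`. -/
def linInfty (m : A →ₗ[F] A →ₗ[F] A) (S : Set A) : Submodule F A :=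
  ⨆ k : ℕ, lin m S k

/-- The length of a set, `min {k | Lin_k(S) = Lin_∞(S)}` (and `⊤` if there is no such `k`). -/
def setLength (m : A →ₗ[F] A →ₗ[F] A) (S : Set A) : ℕ∞ :=
  ⨅ (k : ℕ) (_ : lin m S k = linInfty m S), (k : ℕ∞)

/-- The length of the algebra `(A, m)`: the supremum of the lengths of its generating sets.
When it is finite, it is a maximum, since the set `A` itself is generating. -/
def algLength (m : A →ₗ[F] A →ₗ[F] A) : ℕ∞ :=
  ⨆ (S : Set A) (_ : linInfty m S = ⊤), setLength m S

end Length

end CompositionAlgebra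

end

/-!
Two facts carry the computation of the lengths.

*The unital product.* In a composition algebra every element satisfies `a² = t(a) a - n(a)`, with
`t(a) = n(a, 1)`, and the products `a(ac)` and `(ca)a` obey the same rule. Linearized, these rules
make `ab` and `a(bc)` alternating modulo shorter words. Consequently, a word `ab` that is not a
combination of shorter words forces `1, a, b, ab` to be linearly independent, and such a word
`a(bc)` forces eight independent words (`linearIndependent_of_mul_mul_notMem`), while if there is
no such word of length three there is none of greater length
(`IsCompositionNorm.lin_two_eq_top`). By Hurwitz's theorem, proved here by Cayley–Dickson doubling
(`hurwitz`), the dimension is 1, 2, 4 or 8, and this bounds the length by its binary logarithm. The doubling also produces a generating set with two,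
respectively three, elements, and counting words shows that their lengths attain the bound.

*The other products.* Type III is opposite to type II by conjugation. For types II and IV,
adjoining `1` to the span of the words of length at most `k` gives the span of the words in the
unital product, so a generating set can only fail to have the expected length if `1` itself is not
a combination of words of length at most 2 or 3. In that case all letters are isotropic for a
quadratic form attached to the product, namely `n` for type II and `t² - n` for type IV, and, after
passing to suitable two or three letters if necessary, they are orthogonal to a space of words that
together with `1` spans the algebra. The elements of their span orthogonal to `1` then
lie in the radical of the form, which is contained in `F1`; hence the letters span at most a line,
contradicting the dimension (`IsTwistedProduct.finrank_le_one`). The common properties of the two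
products used in this argument form the structure `IsTwistedProduct`.

In dimension two the length is 2 or 1 according to whether some `a * a` lies outside `F a`. When no
such `a` exists, the quadratic form vanishes on a whole coset `b + F1`, and a polynomial of degree
two with so many zeros occurs only over the field with two elements, for `K(0)` and `K(1)`
respectively.
-/

set_option linter.unusedSectionVars false

namespace CompositionAlgebra

open QuadraticMap (polar)

/-! ### Words, spans of words, and lengths -/

section Words

variable {F A : Type*} [Field F] [AddCommGroup A] [Module F A]
  {m : A →ₗ[F] A →ₗ[F] A} {S : Set A}

lemma IsWord.one_le {k : ℕ} {w : A} (h : IsWord m S k w) : 1 ≤ k := by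
  induction h with
  | letter _ => exact le_rfl
  | mul _ _ h₁ _ => omega

lemma IsWord.letter_or_mul {k : ℕ} {w : A} (h : IsWord m S k w) :
    (k = 1 ∧ w ∈ S) ∨ ∃ i j a b, i + j = k ∧ IsWord m S i a ∧ IsWord m S j b ∧ w = m a b := by
  cases h with
  | letter h => exact .inl ⟨rfl, h⟩
  | mul h₁ h₂ => exact .inr ⟨_, _, _, _, rfl, h₁, h₂, rfl⟩

lemma isWord_one_iff {w : A} : IsWord m S 1 w ↔ w ∈ S := by
  refine ⟨fun h ↦ ?_, .letter⟩
  rcases h.letter_or_mul with ⟨-, h⟩ | ⟨i, j, a, b, hij, ha, hb, -⟩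
  · exact h
  · have := ha.one_le
    have := hb.one_le
    omega

lemma isWord_two_iff {w : A} : IsWord m S 2 w ↔ ∃ a ∈ S, ∃ b ∈ S, w = m a b := by
  constructor
  · intro h
    rcases h.letter_or_mul with ⟨h, -⟩ | ⟨i, j, a, b, hij, ha, hb, rfl⟩
    · omega
    · have hi := ha.one_le
      have hj := hb.one_le
      obtain rfl : i = 1 := by omega
      obtain rfl : j = 1 := by omega
      exact ⟨a, isWord_one_iff.1 ha, b, isWord_one_iff.1 hb, rfl⟩
  · rintro ⟨a, ha, b, hb, rfl⟩
    exact .mul (.letter ha) (.letter hb)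

lemma IsWord.mem_lin {j k : ℕ} {w : A} (h : IsWord m S j w) (hjk : j ≤ k) : w ∈ lin m S k :=
  Submodule.subset_span (.inr ⟨j, hjk, h⟩)

lemma IsUnitElement.mem_lin {f : A} (h : IsUnitElement m f) (k : ℕ) : f ∈ lin m S k :=
  Submodule.subset_span (.inl h)

lemma letter_mem_lin {a : A} (ha : a ∈ S) {k : ℕ} (hk : 1 ≤ k) : a ∈ lin m S k :=
  (IsWord.letter ha).mem_lin hk

lemma lin_mono {j k : ℕ} (h : j ≤ k) : lin m S j ≤ lin m S k := by
  refine Submodule.span_mono ?_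
  rintro w (hw | ⟨i, hi, hw⟩)
  · exact .inl hw
  · exact .inr ⟨i, hi.trans h, hw⟩

lemma lin_le {k : ℕ} {W : Submodule F A} (hu : ∀ f, IsUnitElement m f → f ∈ W)
    (hw : ∀ j ≤ k, ∀ w, IsWord m S j w → w ∈ W) : lin m S k ≤ W := by
  refine Submodule.span_le.2 ?_
  rintro w (h | ⟨i, hi, h⟩)
  · exact hu w h
  · exact hw i hi w h

lemma mul_mem_lin {j k : ℕ} {x y : A} (hx : x ∈ lin m S j) (hy : y ∈ lin m S k) :
    m x y ∈ lin m S (j + k) := by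
  induction hx using Submodule.span_induction with
  | zero => simp
  | add a b _ _ ha hb => simpa using add_mem ha hb
  | smul c a _ ha => simpa using Submodule.smul_mem _ c ha
  | mem a ha =>
    rcases ha with ha | ⟨i, hi, ha⟩
    · rw [(ha y).1]
      exact lin_mono (by omega) hy
    · induction hy using Submodule.span_induction with
      | zero => simp
      | add c d _ _ hc hd => simpa using add_mem hc hd
      | smul c b _ hb => simpa using Submodule.smul_mem _ c hb
      | mem b hb =>
        rcases hb with hb | ⟨l, hl, hb⟩
        · rw [(hb a).2]
          exact ha.mem_lin (by omega)
        · exact (ha.mul hb).mem_lin (by omega)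

lemma lin_le_linInfty (k : ℕ) : lin m S k ≤ linInfty m S := le_iSup (lin m S) k

lemma mem_linInfty_iff {x : A} : x ∈ linInfty m S ↔ ∃ k, x ∈ lin m S k :=
  Submodule.mem_iSup_of_directed _ (Monotone.directed_le fun _ _ h ↦ lin_mono h)

lemma subset_linInfty : S ⊆ linInfty m S := fun _ ha ↦
  lin_le_linInfty 1 (letter_mem_lin ha le_rfl)

lemma mul_mem_linInfty {x y : A} (hx : x ∈ linInfty m S) (hy : y ∈ linInfty m S) :
    m x y ∈ linInfty m S := by
  obtain ⟨j, hj⟩ := mem_linInfty_iff.1 hx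
  obtain ⟨k, hk⟩ := mem_linInfty_iff.1 hy
  exact mem_linInfty_iff.2 ⟨j + k, mul_mem_lin hj hk⟩

lemma linInfty_le {W : Submodule F A} (hu : ∀ f, IsUnitElement m f → f ∈ W) (hS : S ⊆ W)
    (hmul : ∀ x ∈ W, ∀ y ∈ W, m x y ∈ W) : linInfty m S ≤ W := by
  refine iSup_le fun k ↦ lin_le hu fun j _ w hw ↦ ?_
  induction hw with
  | letter h => exact hS h
  | mul _ _ h₁ h₂ => exact hmul _ (h₁ (by omega)) _ (h₂ (by omega))

lemma linInfty_eq_top_of_lin {k : ℕ} (h : lin m S k = ⊤) : linInfty m S = ⊤ :=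
  top_unique (h ▸ lin_le_linInfty k)

lemma linInfty_univ : linInfty m (Set.univ : Set A) = ⊤ :=
  top_unique fun x _ ↦ subset_linInfty (Set.mem_univ x)

lemma lin_zero_of_forall_not_isUnitElement (hu : ∀ f, ¬ IsUnitElement m f) :
    lin m S 0 = ⊥ := by
  refine bot_unique (lin_le (fun f hf ↦ (hu f hf).elim) fun j hj w hw ↦ ?_)
  have := hw.one_le
  omega

lemma lin_one_of_forall_not_isUnitElement (hu : ∀ f, ¬ IsUnitElement m f) :
    lin m S 1 = Submodule.span F S := by
  refine le_antisymm (lin_le (fun f hf ↦ (hu f hf).elim) fun j hj w hw ↦ ?_)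
    (Submodule.span_le.2 fun a ha ↦ letter_mem_lin ha le_rfl)
  obtain rfl : j = 1 := le_antisymm hj hw.one_le
  exact Submodule.subset_span (isWord_one_iff.1 hw)

lemma lin_one_le {W : Submodule F A} (hu : ∀ f, IsUnitElement m f → f ∈ W) (hS : S ⊆ W) :
    lin m S 1 ≤ W := by
  refine lin_le hu fun j hj w hw ↦ ?_
  obtain rfl : j = 1 := le_antisymm hj hw.one_le
  exact hS (isWord_one_iff.1 hw)

lemma lin_two_le {W : Submodule F A} (hu : ∀ f, IsUnitElement m f → f ∈ W) (hS : S ⊆ W)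
    (hm : ∀ a ∈ S, ∀ b ∈ S, m a b ∈ W) : lin m S 2 ≤ W := by
  refine lin_le hu fun j hj w hw ↦ ?_
  have := hw.one_le
  obtain rfl | rfl : j = 1 ∨ j = 2 := by omega
  · exact hS (isWord_one_iff.1 hw)
  · obtain ⟨a, ha, b, hb, rfl⟩ := isWord_two_iff.1 hw
    exact hm a ha b hb

lemma algLength_le {l : ℕ} (h : ∀ S, linInfty m S = ⊤ → lin m S l = ⊤) :
    algLength m ≤ l :=
  iSup₂_le fun S hS ↦ iInf₂_le_of_le l ((h S hS).trans hS.symm) le_rfl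

lemma succ_le_algLength {k : ℕ} (hS : linInfty m S = ⊤) (hk : lin m S k ≠ ⊤) :
    ((k + 1 : ℕ) : ℕ∞) ≤ algLength m := by
  refine le_iSup₂_of_le S hS (le_iInf₂ fun j hj ↦ ?_)
  rw [hS] at hj
  by_contra h
  have hjk : j ≤ k := by
    rw [Nat.cast_le] at h
    omega
  exact hk (top_unique (hj ▸ lin_mono hjk))

lemma algLength_eq_succ {k : ℕ} (h : ∀ S, linInfty m S = ⊤ → lin m S (k + 1) = ⊤)
    (hS : linInfty m S = ⊤) (hk : lin m S k ≠ ⊤) : algLength m = ((k + 1 : ℕ) : ℕ∞) :=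
  le_antisymm (algLength_le h) (succ_le_algLength hS hk)

end Words

section AntiIsomorphism

variable {F A B : Type*} [Field F] [AddCommGroup A] [Module F A] [AddCommGroup B] [Module F B]
  {m : A →ₗ[F] A →ₗ[F] A} {m' : B →ₗ[F] B →ₗ[F] B} {S : Set A}

lemma IsWord.image_of_antihom {φ : A →ₗ[F] B} (hφ : ∀ a b, φ (m a b) = m' (φ b) (φ a)) {k : ℕ}
    {w : A} (h : IsWord m S k w) : IsWord m' (φ '' S) k (φ w) := by
  induction h with
  | letter h => exact .letter ⟨_, h, rfl⟩
  | mul _ _ h₁ h₂ =>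
    rw [hφ, add_comm]
    exact h₂.mul h₁

lemma lin_image_le {φ : A ≃ₗ[F] B} (hφ : ∀ a b, φ (m a b) = m' (φ b) (φ a)) (k : ℕ) :
    (lin m S k).map (φ : A →ₗ[F] B) ≤ lin m' (φ '' S) k := by
  refine Submodule.map_le_iff_le_comap.2 (lin_le (fun f hf ↦ ?_) fun j hj w hw ↦ ?_)
  · refine IsUnitElement.mem_lin (fun b ↦ ?_) k
    obtain ⟨a, rfl⟩ := φ.surjective b
    simp only [LinearEquiv.coe_coe]
    rw [← hφ, ← hφ, (hf a).1, (hf a).2]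
    exact ⟨rfl, rfl⟩
  · exact (hw.image_of_antihom (φ := (φ : A →ₗ[F] B)) hφ).mem_lin hj

lemma lin_image {φ : A ≃ₗ[F] B} (hφ : ∀ a b, φ (m a b) = m' (φ b) (φ a)) (k : ℕ) :
    lin m' (φ '' S) k = (lin m S k).map (φ : A →ₗ[F] B) := by
  refine le_antisymm (fun y hy ↦ ?_) (lin_image_le hφ k)
  have hφ' : ∀ a b, φ.symm (m' a b) = m (φ.symm b) (φ.symm a) := fun a b ↦ by
    rw [LinearEquiv.symm_apply_eq, hφ]
    simp
  have := lin_image_le (S := φ '' S) hφ' k ⟨y, hy, rfl⟩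
  rw [← Set.image_comp] at this
  exact ⟨φ.symm y, by simpa using this, by simp⟩

lemma algLength_le_of_antiisomorphism (φ : A ≃ₗ[F] B)
    (hφ : ∀ a b, φ (m a b) = m' (φ b) (φ a)) : algLength m ≤ algLength m' := by
  refine iSup₂_le fun S hS ↦ ?_
  have hInf : linInfty m' (φ '' S) = (linInfty m S).map (φ : A →ₗ[F] B) := by
    simp only [linInfty, lin_image hφ, Submodule.map_iSup]
  refine le_iSup₂_of_le (φ '' S) (by rw [hInf, hS]; simp) (le_iInf₂ fun k hk ↦ ?_)
  rw [hInf, lin_image hφ] at hk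
  exact iInf₂_le k (Submodule.map_injective_of_injective φ.injective hk)

/-- Anti-isomorphic algebras have the same length: reversing all products preserves lengths of
words. -/
lemma algLength_eq_of_antiisomorphism (φ : A ≃ₗ[F] B)
    (hφ : ∀ a b, φ (m a b) = m' (φ b) (φ a)) : algLength m = algLength m' := by
  refine le_antisymm (algLength_le_of_antiisomorphism φ hφ)
    (algLength_le_of_antiisomorphism φ.symm fun a b ↦ ?_)
  rw [LinearEquiv.symm_apply_eq, hφ]
  simp

end AntiIsomorphism

/-! ### Identities in composition algebras -/


section Identities

variable {F A : Type*} [Field F] [NonAssocRing A] [Module F A] {n : QuadraticForm F A}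

lemma conj_apply (n : QuadraticForm F A) (a : A) : conj n a = polar n a 1 • (1 : A) - a := rfl

namespace IsCompositionNorm

variable (hn : IsCompositionNorm n)
include hn

lemma eq_of_polar {x y : A} (h : ∀ z, polar n x z = polar n y z) : x = y := by
  refine sub_eq_zero.1 (hn.nondegenerate.1 _ fun z ↦ ?_)
  simp [h z]

lemma map_one [Nontrivial A] : n 1 = 1 := by
  have h0 : ∃ a, n a ≠ 0 := by
    by_contra! h
    obtain ⟨x, hx⟩ := exists_ne (0 : A)
    exact hx (hn.eq_of_polar fun z ↦ by simp [polar, h])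
  obtain ⟨a, ha⟩ := h0
  have := hn.map_mul 1 a
  rw [one_mul] at this
  exact (mul_right_cancel₀ ha ((one_mul _).trans this)).symm

lemma polar_mul_left (a b c : A) : polar n (a * b) (a * c) = n a * polar n b c := by
  simp only [polar, ← mul_add, hn.map_mul]
  ring

lemma polar_mul_right (a b c : A) : polar n (a * c) (b * c) = polar n a b * n c := by
  simp only [polar, ← add_mul, hn.map_mul]
  ring

lemma polar_mul_add_polar_mul (a b c d : A) :
    polar n (a * b) (c * d) + polar n (a * d) (c * b) = polar n a c * polar n b d := by
  have h := hn.polar_mul_left (a + c) b d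
  have h' : n (a + c) = n a + n c + polar n a c := QuadraticMap.map_add n a c
  simp only [add_mul, QuadraticMap.polar_add_left, QuadraticMap.polar_add_right,
    hn.polar_mul_left, h', QuadraticMap.polar_comm n (c * b) (a * d)] at h
  linear_combination h

end IsCompositionNorm

variable [IsScalarTower F A A] [SMulCommClass F A A]

namespace IsCompositionNorm

variable (hn : IsCompositionNorm n)
include hn

lemma polar_mul_eq_left (a b c : A) : polar n (a * b) c = polar n b (conj n a * c) := by
  have h := hn.polar_mul_add_polar_mul a b 1 c
  simp only [one_mul] at h
  rw [conj_apply, sub_mul, smul_mul_assoc, one_mul, QuadraticMap.polar_sub_right,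
    QuadraticMap.polar_smul_right, smul_eq_mul, QuadraticMap.polar_comm n b (a * c)]
  linear_combination h

lemma polar_mul_eq_right (a b c : A) : polar n (a * b) c = polar n a (c * conj n b) := by
  have h := hn.polar_mul_add_polar_mul a b c 1
  simp only [mul_one] at h
  rw [conj_apply, mul_sub, mul_smul_comm, mul_one, QuadraticMap.polar_sub_right,
    QuadraticMap.polar_smul_right, smul_eq_mul]
  linear_combination h

lemma conj_mul_mul (a b : A) : conj n a * (a * b) = n a • b := by
  refine hn.eq_of_polar fun z ↦ ?_
  rw [QuadraticMap.polar_comm, ← hn.polar_mul_eq_left, hn.polar_mul_left,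
    QuadraticMap.polar_smul_left, QuadraticMap.polar_comm n z b, smul_eq_mul]

lemma mul_mul_conj (a b : A) : b * a * conj n a = n a • b := by
  refine hn.eq_of_polar fun z ↦ ?_
  rw [QuadraticMap.polar_comm, ← hn.polar_mul_eq_right, hn.polar_mul_right,
    QuadraticMap.polar_smul_left, QuadraticMap.polar_comm n z b, smul_eq_mul, mul_comm]

/-- Left alternativity, with the square expressed by the trace and the norm. -/
lemma mul_mul_self_left (a b : A) : a * (a * b) = polar n a 1 • (a * b) - n a • b := by
  have h := hn.conj_mul_mul a b
  rw [conj_apply, sub_mul, smul_mul_assoc, one_mul] at h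
  rw [← h]
  module

/-- Right alternativity, with the square expressed by the trace and the norm. -/
lemma mul_mul_self_right (a b : A) : b * a * a = polar n a 1 • (b * a) - n a • b := by
  have h := hn.mul_mul_conj a b
  rw [conj_apply, mul_sub, mul_smul_comm, mul_one] at h
  rw [← h]
  module

lemma mul_self_eq (a : A) : a * a = polar n a 1 • a - n a • 1 := by
  simpa using hn.mul_mul_self_left a 1

lemma mul_mul_add_left (a b c : A) : a * (b * c) + b * (a * c) =
    polar n a 1 • (b * c) + polar n b 1 • (a * c) - polar n a b • c := by
  have h := hn.mul_mul_self_left (a + b) c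
  have h' : n (a + b) = n a + n b + polar n a b := QuadraticMap.map_add n a b
  simp only [add_mul, mul_add, QuadraticMap.polar_add_left, h', hn.mul_mul_self_left a c,
    hn.mul_mul_self_left b c] at h
  linear_combination (norm := module) h

lemma mul_mul_add_right (a b c : A) : c * a * b + c * b * a =
    polar n a 1 • (c * b) + polar n b 1 • (c * a) - polar n a b • c := by
  have h := hn.mul_mul_self_right (a + b) c
  have h' : n (a + b) = n a + n b + polar n a b := QuadraticMap.map_add n a b
  simp only [add_mul, mul_add, QuadraticMap.polar_add_left, h', hn.mul_mul_self_right a c,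
    hn.mul_mul_self_right b c] at h
  linear_combination (norm := module) h

lemma mul_add_mul (a b : A) :
    a * b + b * a = polar n a 1 • b + polar n b 1 • a - polar n a b • 1 := by
  simpa using hn.mul_mul_add_right a b 1

lemma polar_mul_one (a b : A) :
    polar n (a * b) 1 = polar n a 1 * polar n b 1 - polar n a b := by
  have h := hn.polar_mul_add_polar_mul a b 1 1
  simp only [one_mul, mul_one] at h
  linear_combination h

lemma conj_mul (a b : A) : conj n (a * b) = conj n b * conj n a := by
  simp only [conj_apply, hn.polar_mul_one, sub_mul, mul_sub, smul_mul_assoc, mul_smul_comm,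
    one_mul, mul_one]
  linear_combination (norm := module) -hn.mul_add_mul a b

lemma conj_mul_self (a : A) : conj n a * a = n a • 1 := by
  simpa using hn.conj_mul_mul a 1

lemma conj_mul_add (a b : A) : conj n a * b + conj n b * a = polar n a b • 1 := by
  simp only [conj_apply, sub_mul, smul_mul_assoc, one_mul]
  linear_combination (norm := module) -hn.mul_add_mul a b

variable [Nontrivial A]

lemma polar_one_one : polar n 1 1 = 2 := by
  simp [hn.map_one]

lemma conj_one : conj n 1 = 1 := by
  rw [conj_apply, hn.polar_one_one]
  module

lemma conj_conj (a : A) : conj n (conj n a) = a := by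
  rw [conj_apply, conj_apply, QuadraticMap.polar_sub_left, QuadraticMap.polar_smul_left,
    hn.polar_one_one]
  module

lemma polar_conj_one (a : A) : polar n (conj n a) 1 = polar n a 1 := by
  rw [conj_apply, QuadraticMap.polar_sub_left, QuadraticMap.polar_smul_left, hn.polar_one_one,
    smul_eq_mul]
  ring

/-- The involution is not the identity unless the algebra consists of the scalars. -/
lemma exists_conj_ne (h : ∃ a : A, a ∉ Submodule.span F {(1 : A)}) : ∃ a, conj n a ≠ a := by
  by_contra! hc
  obtain ⟨a, ha⟩ := h
  have h2 : ∀ a, (2 : F) • a = polar n a 1 • (1 : A) := fun a ↦ by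
    have := hc a
    rw [conj_apply] at this
    linear_combination (norm := module) -this
  by_cases h0 : (2 : F) = 0
  · refine one_ne_zero (hn.eq_of_polar (x := (1 : A)) (y := 0) fun z ↦ ?_)
    have := h2 z
    rw [h0, zero_smul, eq_comm, smul_eq_zero] at this
    rw [QuadraticMap.polar_zero_left, QuadraticMap.polar_comm]
    exact this.resolve_right one_ne_zero
  · refine ha (Submodule.mem_span_singleton.2 ⟨(2 : F)⁻¹ * polar n a 1, ?_⟩)
    rw [mul_smul, ← h2 a, smul_smul, inv_mul_cancel₀ h0, one_smul]

end IsCompositionNorm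

end Identities

/-! ### Lengths of generating sets of unital composition algebras -/

section UnitalLength

variable {F A : Type*} [Field F] [NonAssocRing A] [Module F A]
  [IsScalarTower F A A] [SMulCommClass F A A] {n : QuadraticForm F A} {S : Set A}

lemma isUnitElement_mul_iff {f : A} : IsUnitElement (LinearMap.mul F A) f ↔ f = 1 := by
  refine ⟨fun h ↦ ?_, ?_⟩
  · simpa using (h 1).1
  · rintro rfl a
    simp

lemma one_mem_lin_mul (k : ℕ) : (1 : A) ∈ lin (LinearMap.mul F A) S k :=
  (isUnitElement_mul_iff.2 rfl).mem_lin k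

lemma mul_mem_lin_mul {j k : ℕ} {x y : A} (hx : x ∈ lin (LinearMap.mul F A) S j)
    (hy : y ∈ lin (LinearMap.mul F A) S k) : x * y ∈ lin (LinearMap.mul F A) S (j + k) :=
  mul_mem_lin hx hy

lemma linInfty_mul_le {W : Submodule F A} (h1 : 1 ∈ W) (hS : S ⊆ W)
    (hmul : ∀ x ∈ W, ∀ y ∈ W, x * y ∈ W) : linInfty (LinearMap.mul F A) S ≤ W :=
  linInfty_le (fun f hf ↦ by rwa [isUnitElement_mul_iff.1 hf]) hS hmul

lemma lin_mul_one_le {W : Submodule F A} (h1 : 1 ∈ W) (hS : S ⊆ W) :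
    lin (LinearMap.mul F A) S 1 ≤ W :=
  lin_one_le (fun f hf ↦ by rwa [isUnitElement_mul_iff.1 hf]) hS

lemma lin_mul_two_le {W : Submodule F A} (h1 : 1 ∈ W) (hS : S ⊆ W)
    (hm : ∀ a ∈ S, ∀ b ∈ S, a * b ∈ W) : lin (LinearMap.mul F A) S 2 ≤ W :=
  lin_two_le (fun f hf ↦ by rwa [isUnitElement_mul_iff.1 hf]) hS hm

lemma lin_mul_zero_le : lin (LinearMap.mul F A) S 0 ≤ Submodule.span F {(1 : A)} := by
  refine lin_le (fun f hf ↦ ?_) fun j hj w hw ↦ ?_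
  · rw [isUnitElement_mul_iff.1 hf]
    exact Submodule.mem_span_singleton_self _
  · have := hw.one_le
    omega

namespace IsCompositionNorm

variable (hn : IsCompositionNorm n)
include hn

lemma lin_one_eq_top (hS : linInfty (LinearMap.mul F A) S = ⊤)
    (h : ∀ a ∈ S, ∀ b ∈ S, a * b ∈ lin (LinearMap.mul F A) S 1) :
    lin (LinearMap.mul F A) S 1 = ⊤ := by
  set U := lin (LinearMap.mul F A) S 1 with hU
  have h1 : (1 : A) ∈ U := one_mem_lin_mul 1
  have hSU : S ⊆ U := fun a ha ↦ letter_mem_lin ha le_rfl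
  have hl : ∀ a ∈ S, U ≤ U.comap (LinearMap.mul F A a) := fun a ha ↦
    lin_mul_one_le (by simpa using hSU ha) fun b hb ↦ by simpa using h a ha b hb
  refine top_unique (hS ▸ linInfty_mul_le h1 hSU fun x hx y hy ↦ ?_)
  have : U ≤ U.comap ((LinearMap.mul F A).flip y) :=
    lin_mul_one_le (by simpa using hy) fun a ha ↦ by simpa using hl a ha hy
  simpa using this hx

/-- If words of length three contribute nothing new, then neither do longer ones. -/
lemma lin_two_eq_top (hS : linInfty (LinearMap.mul F A) S = ⊤)
    (h : ∀ a ∈ S, ∀ b ∈ S, ∀ c ∈ S, a * (b * c) ∈ lin (LinearMap.mul F A) S 2) :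
    lin (LinearMap.mul F A) S 2 = ⊤ := by
  set U := lin (LinearMap.mul F A) S 2 with hU
  have h1 : (1 : A) ∈ U := one_mem_lin_mul 2
  have hSU : S ⊆ U := fun a ha ↦ letter_mem_lin ha one_le_two
  have hSS : ∀ a ∈ S, ∀ b ∈ S, a * b ∈ U := fun a ha b hb ↦
    mul_mem_lin_mul (j := 1) (k := 1) (letter_mem_lin ha le_rfl) (letter_mem_lin hb le_rfl)
  have hl : ∀ a ∈ S, ∀ y ∈ U, a * y ∈ U := fun a ha ↦ by
    have : U ≤ U.comap (LinearMap.mul F A a) :=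
      lin_mul_two_le (by simpa using hSU ha) (fun b hb ↦ by simpa using hSS a ha b hb)
        fun b hb c hc ↦ by simpa using h a ha b hb c hc
    exact fun y hy ↦ by simpa using this hy
  have hr : ∀ a ∈ S, ∀ b ∈ S, ∀ c ∈ S, a * b * c ∈ U := fun a ha b hb c hc ↦ by
    rw [eq_sub_of_add_eq (hn.mul_add_mul (a * b) c)]
    exact sub_mem (sub_mem (add_mem (U.smul_mem _ (hSU hc)) (U.smul_mem _ (hSS a ha b hb)))
      (U.smul_mem _ h1)) (h c hc a ha b hb)
  have hll : ∀ a ∈ S, ∀ b ∈ S, ∀ y ∈ U, a * b * y ∈ U := fun a ha b hb ↦ by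
    have : U ≤ U.comap (LinearMap.mul F A (a * b)) := by
      refine lin_mul_two_le (by simpa using hSS a ha b hb)
        (fun c hc ↦ by simpa using hr a ha b hb c hc) fun c hc d hd ↦ ?_
      rw [Submodule.mem_comap, LinearMap.mul_apply',
        eq_sub_of_add_eq (hn.mul_mul_add_left (a * b) c d)]
      exact sub_mem (sub_mem (add_mem (U.smul_mem _ (hSS c hc d hd))
        (U.smul_mem _ (hr a ha b hb d hd))) (U.smul_mem _ (hSU hd)))
        (hl c hc _ (hr a ha b hb d hd))
    exact fun y hy ↦ by simpa using this hy
  refine top_unique (hS ▸ linInfty_mul_le h1 hSU fun x hx y hy ↦ ?_)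
  have : U ≤ U.comap ((LinearMap.mul F A).flip y) :=
    lin_mul_two_le (by simpa using hy) (fun a ha ↦ by simpa using hl a ha y hy)
      fun a ha b hb ↦ by simpa using hll a ha b hb y hy
  simpa using this hx

variable [Nontrivial A]

lemma linearIndependent_of_mul_notMem {a b : A} {U : Submodule F A} (h1 : 1 ∈ U) (ha : a ∈ U)
    (hb : b ∈ U) (h : a * b ∉ U) : LinearIndependent F ![1, a, b, a * b] := by
  have hw : U.mkQ (a * b) ≠ 0 := fun h0 ↦ h ((Submodule.Quotient.mk_eq_zero U).1 h0)
  have hU : ∀ {y}, y ∈ U → U.mkQ y = 0 := fun hy ↦ (Submodule.Quotient.mk_eq_zero U).2 hy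
  have haa : U.mkQ (a * a) = 0 := by simp [hn.mul_self_eq a, hU ha, hU h1, -Submodule.mkQ_apply]
  have hbb : U.mkQ (b * b) = 0 := by simp [hn.mul_self_eq b, hU hb, hU h1, -Submodule.mkQ_apply]
  rw [Fintype.linearIndependent_iff]
  intro g hg
  simp only [Fin.sum_univ_succ, Fin.sum_univ_zero, Matrix.cons_val_zero, Matrix.cons_val_succ,
    add_zero] at hg
  simp only [Fin.forall_fin_succ, IsEmpty.forall_iff, and_true]
  generalize g 0 = g0, g (Fin.succ 0) = g1, g (Fin.succ (Fin.succ 0)) = g2,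
    g (Fin.succ (Fin.succ (Fin.succ 0))) = g3 at hg ⊢
  have e3 : g3 = 0 := by
    have := congrArg U.mkQ hg
    simpa only [map_add, map_smul, map_zero, hU h1, hU ha, hU hb, smul_zero, zero_add,
      smul_eq_zero, hw, or_false] using this
  subst e3
  have e1 : g1 = 0 := by
    have := congrArg (fun x ↦ U.mkQ (x * b)) hg
    simpa only [add_mul, smul_mul_assoc, one_mul, zero_smul, zero_mul, map_add, map_smul,
      map_zero, hU hb, hbb, smul_zero, zero_add, add_zero, smul_eq_zero, hw, or_false] using this
  subst e1
  have e2 : g2 = 0 := by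
    have := congrArg (fun x ↦ U.mkQ (a * x)) hg
    simpa only [mul_add, mul_smul_comm, mul_one, zero_smul, mul_zero, map_add, map_smul,
      map_zero, hU ha, smul_zero, zero_add, add_zero, smul_eq_zero, hw, or_false] using this
  subst e2
  simpa using hg

/-- A word of length three in `a`, `b`, `c` that is not a combination of shorter words makes the
words `1, a, b, c, ab, ac, bc, a(bc)` linearly independent: modulo shorter words the product
`x(yz)` is alternating, so multiplying a linear relation by suitable letters isolates each of its
coefficients. -/
lemma linearIndependent_of_mul_mul_notMem {a b c : A} {U : Submodule F A} (h1 : 1 ∈ U)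
    (hS : ∀ x ∈ ({a, b, c} : Set A), x ∈ U)
    (hSS : ∀ x ∈ ({a, b, c} : Set A), ∀ y ∈ ({a, b, c} : Set A), x * y ∈ U)
    (h : a * (b * c) ∉ U) :
    LinearIndependent F ![1, a, b, c, a * b, a * c, b * c, a * (b * c)] := by
  have hw : U.mkQ (a * (b * c)) ≠ 0 := fun h0 ↦ h ((Submodule.Quotient.mk_eq_zero U).1 h0)
  have hU : ∀ {y}, y ∈ U → U.mkQ y = 0 := fun hy ↦ (Submodule.Quotient.mk_eq_zero U).2 hy
  have p0 : U.mkQ 1 = 0 := hU h1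
  have p1 : ∀ x ∈ ({a, b, c} : Set A), U.mkQ x = 0 := fun x hx ↦ hU (hS x hx)
  have p2 : ∀ x ∈ ({a, b, c} : Set A), ∀ y ∈ ({a, b, c} : Set A), U.mkQ (x * y) = 0 :=
    fun x hx y hy ↦ hU (hSS x hx y hy)
  have s1 : ∀ x ∈ ({a, b, c} : Set A), ∀ y ∈ ({a, b, c} : Set A), ∀ z ∈ ({a, b, c} : Set A),
      U.mkQ (x * (y * z)) = - U.mkQ (y * (x * z)) := fun x hx y hy z hz ↦ by
    rw [eq_sub_of_add_eq (hn.mul_mul_add_left x y z)]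
    simp only [map_sub, map_add, map_smul, p2 x hx z hz, p2 y hy z hz, p1 z hz, smul_zero,
      add_zero, sub_zero, zero_sub]
  have s2 : ∀ x ∈ ({a, b, c} : Set A), ∀ y ∈ ({a, b, c} : Set A), ∀ z ∈ ({a, b, c} : Set A),
      U.mkQ (x * (y * z)) = - U.mkQ (x * (z * y)) := fun x hx y hy z hz ↦ by
    rw [eq_sub_of_add_eq (hn.mul_add_mul y z)]
    simp only [mul_sub, mul_add, mul_smul_comm, mul_one, map_sub, map_add, map_smul, p2 x hx z hz,
      p2 x hx y hy, p1 x hx, smul_zero, add_zero, sub_zero, zero_sub]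
  have d1 : ∀ x ∈ ({a, b, c} : Set A), ∀ y ∈ ({a, b, c} : Set A), U.mkQ (x * (x * y)) = 0 :=
    fun x hx y hy ↦ by
      rw [hn.mul_mul_self_left]
      simp only [map_sub, map_smul, p2 x hx y hy, p1 y hy, smul_zero, sub_zero]
  have d2 : ∀ x ∈ ({a, b, c} : Set A), ∀ y ∈ ({a, b, c} : Set A), U.mkQ (x * (y * x)) = 0 :=
    fun x hx y hy ↦ by rw [s2 x hx y hy x hx, d1 x hx y hy, neg_zero]
  have d3 : ∀ x ∈ ({a, b, c} : Set A), ∀ y ∈ ({a, b, c} : Set A), U.mkQ (x * (y * y)) = 0 :=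
    fun x hx y hy ↦ by rw [s1 x hx y hy y hy, d2 y hy x hx, neg_zero]
  have ha : a ∈ ({a, b, c} : Set A) := by simp
  have hb : b ∈ ({a, b, c} : Set A) := by simp
  have hc : c ∈ ({a, b, c} : Set A) := by simp
  have w1 : U.mkQ (b * (a * c)) = - U.mkQ (a * (b * c)) := s1 b hb a ha c hc
  have w2 : U.mkQ (c * (a * b)) = U.mkQ (a * (b * c)) := by
    rw [s1 c hc a ha b hb, s2 a ha c hc b hb, neg_neg]
  rw [Fintype.linearIndependent_iff]
  intro g hg
  simp only [Fin.sum_univ_succ, Fin.sum_univ_zero, Matrix.cons_val_zero, Matrix.cons_val_succ,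
    add_zero] at hg
  simp only [Fin.forall_fin_succ, IsEmpty.forall_iff, and_true]
  generalize g 0 = g0, g (Fin.succ 0) = g1, g (Fin.succ (Fin.succ 0)) = g2,
    g (Fin.succ (Fin.succ (Fin.succ 0))) = g3,
    g (Fin.succ (Fin.succ (Fin.succ (Fin.succ 0)))) = g4,
    g (Fin.succ (Fin.succ (Fin.succ (Fin.succ (Fin.succ 0))))) = g5,
    g (Fin.succ (Fin.succ (Fin.succ (Fin.succ (Fin.succ (Fin.succ 0)))))) = g6,
    g (Fin.succ (Fin.succ (Fin.succ (Fin.succ (Fin.succ (Fin.succ (Fin.succ 0))))))) = g7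
    at hg ⊢
  have e7 : g7 = 0 := by
    have := congrArg U.mkQ hg
    simpa only [map_add, map_smul, map_zero, p0, p1 a ha, p1 b hb, p1 c hc, p2 a ha b hb,
      p2 a ha c hc, p2 b hb c hc, smul_zero, zero_add, smul_eq_zero, hw, or_false] using this
  subst e7
  have e4 : g4 = 0 := by
    have := congrArg (fun x ↦ U.mkQ (c * x)) hg
    simpa only [mul_add, mul_smul_comm, mul_one, zero_smul, mul_zero, map_add, map_smul, map_zero,
      p1 c hc, p2 c hc a ha, p2 c hc b hb, p2 c hc c hc, w2, d2 c hc a ha, d2 c hc b hb,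
      smul_zero, zero_add, add_zero, smul_eq_zero, hw, or_false] using this
  subst e4
  have e5 : g5 = 0 := by
    have := congrArg (fun x ↦ U.mkQ (b * x)) hg
    simpa only [mul_add, mul_smul_comm, mul_one, zero_smul, mul_zero, map_add, map_smul, map_zero,
      p1 b hb, p2 b hb a ha, p2 b hb b hb, p2 b hb c hc, w1, d1 b hb c hc,
      smul_zero, zero_add, add_zero, smul_eq_zero, neg_eq_zero, hw, or_false] using this
  subst e5
  have e6 : g6 = 0 := by
    have := congrArg (fun x ↦ U.mkQ (a * x)) hg
    simpa only [mul_add, mul_smul_comm, mul_one, zero_smul, mul_zero, map_add, map_smul, map_zero,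
      p1 a ha, p2 a ha a ha, p2 a ha b hb, p2 a ha c hc,
      smul_zero, zero_add, add_zero, smul_eq_zero, hw, or_false] using this
  subst e6
  have e1 : g1 = 0 := by
    have := congrArg (fun x ↦ U.mkQ (b * (x * c))) hg
    simpa only [add_mul, mul_add, smul_mul_assoc, mul_smul_comm, one_mul, zero_smul, zero_mul,
      mul_zero, map_add, map_smul, map_zero, p2 b hb c hc, w1, d1 b hb c hc, d3 b hb c hc,
      smul_zero, zero_add, add_zero, smul_eq_zero, neg_eq_zero, hw, or_false] using this
  subst e1
  have e2 : g2 = 0 := by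
    have := congrArg (fun x ↦ U.mkQ (a * (x * c))) hg
    simpa only [add_mul, mul_add, smul_mul_assoc, mul_smul_comm, one_mul, zero_smul, zero_mul,
      mul_zero, map_add, map_smul, map_zero, p2 a ha c hc, d3 a ha c hc,
      smul_zero, zero_add, add_zero, smul_eq_zero, hw, or_false] using this
  subst e2
  have e3 : g3 = 0 := by
    have := congrArg (fun x ↦ U.mkQ (a * (b * x))) hg
    simpa only [mul_add, mul_smul_comm, mul_one, zero_smul,
      mul_zero, map_add, map_smul, map_zero, p2 a ha b hb,
      smul_zero, zero_add, add_zero, smul_eq_zero, hw, or_false] using this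
  subst e3
  simpa using hg

lemma lin_one_eq_top_or (hS : linInfty (LinearMap.mul F A) S = ⊤) :
    lin (LinearMap.mul F A) S 1 = ⊤ ∨
      ∃ a ∈ S, ∃ b ∈ S, LinearIndependent F ![1, a, b, a * b] := by
  by_cases h : ∀ a ∈ S, ∀ b ∈ S, a * b ∈ lin (LinearMap.mul F A) S 1
  · exact .inl (hn.lin_one_eq_top hS h)
  · push Not at h
    obtain ⟨a, ha, b, hb, h⟩ := h
    exact .inr ⟨a, ha, b, hb, hn.linearIndependent_of_mul_notMem (one_mem_lin_mul 1)
      (letter_mem_lin ha le_rfl) (letter_mem_lin hb le_rfl) h⟩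

lemma lin_two_eq_top_or (hS : linInfty (LinearMap.mul F A) S = ⊤) :
    lin (LinearMap.mul F A) S 2 = ⊤ ∨ ∃ a ∈ S, ∃ b ∈ S, ∃ c ∈ S,
      LinearIndependent F ![1, a, b, c, a * b, a * c, b * c, a * (b * c)] := by
  by_cases h : ∀ a ∈ S, ∀ b ∈ S, ∀ c ∈ S, a * (b * c) ∈ lin (LinearMap.mul F A) S 2
  · exact .inl (hn.lin_two_eq_top hS h)
  · push Not at h
    obtain ⟨a, ha, b, hb, c, hc, h⟩ := h
    have hsub : ∀ x ∈ ({a, b, c} : Set A), x ∈ S := by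
      rintro x (rfl | rfl | rfl) <;> assumption
    exact .inr ⟨a, ha, b, hb, c, hc, hn.linearIndependent_of_mul_mul_notMem (one_mem_lin_mul 2)
      (fun x hx ↦ letter_mem_lin (hsub x hx) one_le_two)
      (fun x hx y hy ↦ mul_mem_lin_mul (j := 1) (k := 1) (letter_mem_lin (hsub x hx) le_rfl)
        (letter_mem_lin (hsub y hy) le_rfl)) h⟩

end IsCompositionNorm

end UnitalLength

/-! ### Cayley–Dickson doubling and Hurwitz's theorem -/

section Hurwitz

variable {F A : Type*} [Field F] [NonAssocRing A] [Module F A] {n : QuadraticForm F A}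

/-- A finite-dimensional unital subalgebra on which the polar form of `n` is nondegenerate. -/
structure IsRegularSubalgebra (n : QuadraticForm F A) (B : Submodule F A) : Prop where
  one_mem : 1 ∈ B
  mul_mem : ∀ {x y : A}, x ∈ B → y ∈ B → x * y ∈ B
  nondegenerate : ∀ x ∈ B, (∀ y ∈ B, polar n x y = 0) → x = 0
  finite : FiniteDimensional F B

variable [IsScalarTower F A A] [SMulCommClass F A A]

/-- The Cayley–Dickson double `B + Bv` of `B` inside `A`. -/
def double (B : Submodule F A) (v : A) : Submodule F A :=
  B ⊔ B.map (LinearMap.mulRight F v)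

lemma mem_double_iff {B : Submodule F A} {v x : A} :
    x ∈ double B v ↔ ∃ a ∈ B, ∃ b ∈ B, x = a + b * v := by
  simp only [double, Submodule.mem_sup, Submodule.mem_map, LinearMap.mulRight_apply]
  constructor
  · rintro ⟨a, ha, _, ⟨b, hb, rfl⟩, rfl⟩
    exact ⟨a, ha, b, hb, rfl⟩
  · rintro ⟨a, ha, b, hb, rfl⟩
    exact ⟨a, ha, _, ⟨b, hb, rfl⟩, rfl⟩

lemma le_double (B : Submodule F A) (v : A) : B ≤ double B v := le_sup_left

lemma double_le_linInfty {B : Submodule F A} {v : A} {S : Set A}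
    (hB : B ≤ linInfty (LinearMap.mul F A) S) (hv : v ∈ S) :
    double B v ≤ linInfty (LinearMap.mul F A) S := by
  intro x hx
  obtain ⟨a, ha, b, hb, rfl⟩ := mem_double_iff.1 hx
  exact add_mem (hB ha) (mul_mem_linInfty (hB hb) (subset_linInfty hv))

namespace IsRegularSubalgebra

variable {B : Submodule F A} (hB : IsRegularSubalgebra n B)
include hB

lemma conj_mem {x : A} (hx : x ∈ B) : conj n x ∈ B :=
  sub_mem (B.smul_mem _ hB.one_mem) hx

lemma exists_sub_orthogonal (x : A) : ∃ b ∈ B, ∀ y ∈ B, polar n y (x - b) = 0 := by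
  have := hB.finite
  let f : B →ₗ[F] Module.Dual F B := n.polarBilin.compl₁₂ B.subtype B.subtype
  have hf : Function.Injective f := by
    refine (injective_iff_map_eq_zero f).2 fun b hb ↦ Subtype.ext ?_
    exact hB.nondegenerate b b.2 fun y hy ↦ LinearMap.congr_fun hb ⟨y, hy⟩
  have hs : Function.Surjective f :=
    (LinearMap.injective_iff_surjective_of_finrank_eq_finrank Subspace.dual_finrank_eq.symm).1 hf
  obtain ⟨b, hb⟩ := hs ((n.polarBilin x).comp B.subtype)
  refine ⟨b, b.2, fun y hy ↦ ?_⟩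
  have : polar n b y = polar n x y := LinearMap.congr_fun hb ⟨y, hy⟩
  rw [QuadraticMap.polar_sub_right, QuadraticMap.polar_comm n y x, QuadraticMap.polar_comm n y b,
    this, sub_self]

variable (hn : IsCompositionNorm n)
include hn

lemma exists_orthogonal (hB' : B ≠ ⊤) : ∃ v, (∀ b ∈ B, polar n b v = 0) ∧ n v ≠ 0 := by
  obtain ⟨x, -, hx⟩ := SetLike.exists_of_lt (lt_top_iff_ne_top.2 hB')
  obtain ⟨b, hb, hxb⟩ := hB.exists_sub_orthogonal x
  have h0 : x - b ≠ 0 := fun h ↦ hx (sub_eq_zero.1 h ▸ hb)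
  obtain ⟨z, hz⟩ : ∃ z, polar n (x - b) z ≠ 0 := by
    by_contra! h
    exact h0 (hn.nondegenerate.1 _ h)
  obtain ⟨c, hc, hzc⟩ := hB.exists_sub_orthogonal z
  by_contra! h
  -- if `x - b`, `z - c` and their sum are isotropic, then the polar form of the first two vanishes
  have h1 := h (x - b + (z - c)) fun y hy ↦ by
    rw [QuadraticMap.polar_add_right, hxb y hy, hzc y hy, add_zero]
  rw [QuadraticMap.map_add (n : A → F), h _ hxb, h _ hzc, QuadraticMap.polar_sub_right,
    QuadraticMap.polar_comm n (x - b) c, hxb c hc] at h1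
  exact hz (by simpa using h1)

variable {v : A} (hv : ∀ b ∈ B, polar n b v = 0)
include hv

lemma polar_one_eq_zero : polar n v 1 = 0 := by
  rw [QuadraticMap.polar_comm, hv 1 hB.one_mem]

lemma polar_mul_eq_zero {a b : A} (ha : a ∈ B) (hb : b ∈ B) : polar n a (b * v) = 0 := by
  rw [QuadraticMap.polar_comm, hn.polar_mul_eq_left, QuadraticMap.polar_comm,
    hv _ (hB.mul_mem (hB.conj_mem hb) ha)]

lemma polar_mul_one_eq_zero {b : A} (hb : b ∈ B) : polar n (b * v) 1 = 0 := by
  rw [QuadraticMap.polar_comm, hB.polar_mul_eq_zero hn hv hB.one_mem hb]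

lemma mul_mul_right {a : A} (b : A) (ha : a ∈ B) : b * v * a = b * conj n a * v := by
  have h := hn.mul_mul_add_right a v b
  rw [hv a ha, hB.polar_one_eq_zero hn hv] at h
  rw [conj_apply, mul_sub, sub_mul, mul_smul_comm, mul_one, smul_mul_assoc]
  linear_combination (norm := module) h

lemma mul_mul_left {a b : A} (ha : a ∈ B) (hb : b ∈ B) : a * (b * v) = b * a * v := by
  have h := hn.mul_add_mul a (b * v)
  rw [hB.polar_mul_eq_zero hn hv ha hb, hB.polar_mul_one_eq_zero hn hv hb,
    hB.mul_mul_right hn hv b ha, conj_apply, mul_sub, sub_mul, mul_smul_comm, mul_one,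
    smul_mul_assoc] at h
  linear_combination (norm := module) h

lemma mul_mul_mul {a b : A} (ha : a ∈ B) (hb : b ∈ B) :
    a * v * (b * v) = -n v • (conj n b * a) := by
  have h := hn.mul_mul_add_right v (b * v) a
  have h' := hn.mul_mul_self_right v (b * a)
  have h'' := hn.mul_add_mul a b
  have hp : polar n v (b * v) = polar n b 1 * n v := by
    rw [QuadraticMap.polar_comm, ← hn.polar_mul_right, one_mul]
  rw [hB.mul_mul_left hn hv ha hb, hB.polar_mul_one_eq_zero hn hv hb,
    hB.polar_one_eq_zero hn hv, h', hp, hB.polar_one_eq_zero hn hv] at h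
  rw [conj_apply, sub_mul, smul_mul_assoc, one_mul]
  linear_combination (norm := module) h

/-- A regular subalgebra that is not the whole composition algebra is associative. -/
lemma mul_assoc_of_orthogonal (hnv : n v ≠ 0) {a b c : A} (ha : a ∈ B) (hb : b ∈ B)
    (hc : c ∈ B) : a * b * c = a * (b * c) := by
  refine sub_eq_zero.1 (hB.nondegenerate _ (sub_mem (hB.mul_mem (hB.mul_mem ha hb) hc)
    (hB.mul_mem ha (hB.mul_mem hb hc))) fun y hy ↦ ?_)
  have h := hn.polar_mul_add_polar_mul b c (y * v) (a * v)
  rw [hB.polar_mul_eq_zero hn hv hb hy, zero_mul, hB.mul_mul_mul hn hv hy ha,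
    hB.mul_mul_left hn hv hb ha, hB.mul_mul_right hn hv y hc, hn.polar_mul_right,
    QuadraticMap.polar_smul_right, smul_eq_mul] at h
  rw [QuadraticMap.polar_sub_left, hn.polar_mul_eq_right (a * b) c y,
    hn.polar_mul_eq_left a (b * c) y]
  exact (mul_eq_zero.1 (by linear_combination h)).resolve_right hnv

lemma double_isRegularSubalgebra (hnv : n v ≠ 0) : IsRegularSubalgebra n (double B v) where
  one_mem := le_double B v hB.one_mem
  mul_mem := by
    intro x y hx hy
    obtain ⟨a, ha, b, hb, rfl⟩ := mem_double_iff.1 hx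
    obtain ⟨c, hc, d, hd, rfl⟩ := mem_double_iff.1 hy
    refine mem_double_iff.2 ⟨a * c + -n v • (conj n d * b),
      add_mem (hB.mul_mem ha hc) (B.smul_mem _ (hB.mul_mem (hB.conj_mem hd) hb)),
      d * a + b * conj n c, add_mem (hB.mul_mem hd ha) (hB.mul_mem hb (hB.conj_mem hc)), ?_⟩
    rw [add_mul, mul_add, mul_add, hB.mul_mul_left hn hv ha hd, hB.mul_mul_right hn hv b hc,
      hB.mul_mul_mul hn hv hb hd, add_mul]
    abel
  nondegenerate := by
    intro x hx h
    obtain ⟨a, ha, b, hb, rfl⟩ := mem_double_iff.1 hx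
    have ha0 : a = 0 := hB.nondegenerate a ha fun y hy ↦ by
      have := h y (le_double B v hy)
      rwa [QuadraticMap.polar_add_left, QuadraticMap.polar_comm n (b * v),
        hB.polar_mul_eq_zero hn hv hy hb, add_zero] at this
    have hb0 : b = 0 := hB.nondegenerate b hb fun y hy ↦ by
      have := h (y * v) (mem_double_iff.2 ⟨0, zero_mem _, y, hy, (zero_add _).symm⟩)
      rw [ha0, zero_add, hn.polar_mul_right] at this
      exact (mul_eq_zero.1 this).resolve_right hnv
    rw [ha0, hb0, zero_mul, add_zero]
  finite := by
    have := hB.finite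
    exact Submodule.finiteDimensional_sup _ _

lemma finrank_double (hnv : n v ≠ 0) :
    Module.finrank F (double B v) = 2 * Module.finrank F B := by
  have := hB.finite
  have hinj : Function.Injective (LinearMap.mulRight F v) := by
    refine (injective_iff_map_eq_zero _).2 fun x hx ↦ ?_
    rw [LinearMap.mulRight_apply] at hx
    have h := hn.mul_mul_self_right v x
    rw [hx, zero_mul, smul_zero, zero_sub, eq_comm, neg_eq_zero] at h
    exact (smul_eq_zero.1 h).resolve_left hnv
  have hinf : B ⊓ B.map (LinearMap.mulRight F v) = ⊥ := by
    refine (Submodule.eq_bot_iff _).2 ?_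
    rintro _ ⟨hx, b, hb, rfl⟩
    refine hB.nondegenerate _ hx fun y hy ↦ ?_
    rw [QuadraticMap.polar_comm]
    exact hB.polar_mul_eq_zero hn hv hy hb
  have h := Submodule.finrank_sup_add_finrank_inf_eq B (B.map (LinearMap.mulRight F v))
  rw [hinf, finrank_bot, add_zero,
    ← (Submodule.equivMapOfInjective _ hinj B).finrank_eq] at h
  rw [double, h, two_mul]

lemma commute_of_double_assoc (hnv : n v ≠ 0)
    (h : ∀ x ∈ double B v, ∀ y ∈ double B v, ∀ z ∈ double B v, x * y * z = x * (y * z))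
    {a b : A} (ha : a ∈ B) (hb : b ∈ B) : a * b = b * a := by
  have hvB : v ∈ double B v := mem_double_iff.2 ⟨0, zero_mem _, 1, hB.one_mem, by simp⟩
  have h1 := h a (le_double B v ha) b (le_double B v hb) v hvB
  rw [hB.mul_mul_left hn hv ha hb] at h1
  have h2 := hn.mul_mul_self_right v (a * b - b * a)
  rw [sub_mul, h1, sub_self, zero_mul, smul_zero, zero_sub, eq_comm, neg_eq_zero] at h2
  exact sub_eq_zero.1 ((smul_eq_zero.1 h2).resolve_left hnv)

lemma conj_eq_of_double_comm (hnv : n v ≠ 0)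
    (h : ∀ x ∈ double B v, ∀ y ∈ double B v, x * y = y * x) {a : A} (ha : a ∈ B) :
    conj n a = a := by
  have hvB : v ∈ double B v := mem_double_iff.2 ⟨0, zero_mem _, 1, hB.one_mem, by simp⟩
  have h1 := h a (le_double B v ha) v hvB
  have h2 := hB.mul_mul_right hn hv 1 ha
  rw [one_mul, one_mul, ← h1] at h2
  have h3 := hn.mul_mul_self_right v (conj n a - a)
  rw [sub_mul, h2, sub_self, zero_mul, smul_zero, zero_sub, eq_comm, neg_eq_zero] at h3
  exact sub_eq_zero.1 ((smul_eq_zero.1 h3).resolve_left hnv)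

end IsRegularSubalgebra

namespace IsCompositionNorm

variable [Nontrivial A] (hn : IsCompositionNorm n)
include hn

lemma exists_four_mul_ne (h : ∃ a : A, a ∉ Submodule.span F {(1 : A)}) :
    ∃ a, 4 * n a ≠ polar n a 1 * polar n a 1 := by
  by_contra! hc
  obtain ⟨a, ha⟩ := h
  by_cases h0 : (2 : F) = 0
  · refine one_ne_zero (hn.eq_of_polar (x := (1 : A)) (y := 0) fun z ↦ ?_)
    have := hc z
    rw [show (4 : F) = 2 * 2 by norm_num, h0, zero_mul, zero_mul, eq_comm, mul_self_eq_zero] at this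
    rw [QuadraticMap.polar_zero_left, QuadraticMap.polar_comm, this]
  · have h2 : (2 : F) • a = polar n a 1 • (1 : A) := hn.eq_of_polar fun z ↦ by
      have h' : n (a + z) = n a + n z + polar n a z := QuadraticMap.map_add n a z
      have := hc (a + z)
      rw [h', QuadraticMap.polar_add_left] at this
      rw [QuadraticMap.polar_smul_left, QuadraticMap.polar_smul_left, smul_eq_mul, smul_eq_mul,
        QuadraticMap.polar_comm n 1 z]
      refine mul_left_cancel₀ h0 ?_
      linear_combination this - hc a - hc z
    refine ha (Submodule.mem_span_singleton.2 ⟨(2 : F)⁻¹ * polar n a 1, ?_⟩)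
    rw [mul_smul, ← h2, smul_smul, inv_mul_cancel₀ h0, one_smul]

lemma isRegularSubalgebra_span_pair {a : A} (ha : 4 * n a ≠ polar n a 1 * polar n a 1) :
    IsRegularSubalgebra n (Submodule.span F {1, a}) where
  one_mem := Submodule.subset_span (by simp)
  mul_mem := by
    intro x y hx hy
    obtain ⟨p, q, rfl⟩ := Submodule.mem_span_pair.1 hx
    obtain ⟨r, s, rfl⟩ := Submodule.mem_span_pair.1 hy
    refine Submodule.mem_span_pair.2
      ⟨p * r - q * s * n a, p * s + q * r + q * s * polar n a 1, ?_⟩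
    simp only [add_mul, mul_add, smul_mul_assoc, mul_smul_comm, one_mul, mul_one, hn.mul_self_eq]
    module
  nondegenerate := by
    intro x hx h
    obtain ⟨p, q, rfl⟩ := Submodule.mem_span_pair.1 hx
    have h1 := h 1 (Submodule.subset_span (by simp))
    have h2 := h a (Submodule.subset_span (by simp))
    have h3 : polar n a a = 2 * n a := by simp
    simp only [QuadraticMap.polar_add_left, QuadraticMap.polar_smul_left, smul_eq_mul,
      hn.polar_one_one, QuadraticMap.polar_comm n 1 a, h3] at h1 h2
    have hq : q = 0 := by
      refine (mul_eq_zero.1 ?_).resolve_right (sub_ne_zero.2 ha)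
      linear_combination 2 * h2 - polar n a 1 * h1
    have hp : p = 0 := by
      refine (mul_eq_zero.1 ?_).resolve_right (sub_ne_zero.2 ha)
      linear_combination 2 * n a * h1 - polar n a 1 * h2
    simp [hp, hq]
  finite := by
    have : ({1, a} : Set A).Finite := by simp
    exact FiniteDimensional.span_of_finite F this

lemma linearIndependent_pair {a : A} (ha : 4 * n a ≠ polar n a 1 * polar n a 1) :
    LinearIndependent F ![1, a] := by
  rw [LinearIndependent.pair_iff' one_ne_zero]
  rintro c rfl
  refine ha ?_
  rw [QuadraticMap.map_smul, QuadraticMap.polar_smul_left, hn.polar_one_one, hn.map_one,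
    smul_eq_mul, smul_eq_mul]
  ring

lemma conj_ne_self {a : A} (ha : 4 * n a ≠ polar n a 1 * polar n a 1) : conj n a ≠ a := by
  intro h
  rw [conj_apply] at h
  have h2 : (2 : F) • a = polar n a 1 • (1 : A) := by
    linear_combination (norm := module) -h
  have h3 := congrArg n h2
  rw [QuadraticMap.map_smul, QuadraticMap.map_smul, hn.map_one, smul_eq_mul, smul_eq_mul] at h3
  exact ha (by linear_combination h3)

/-- Hurwitz's theorem, together with the small generating sets supplied by the doubling process. -/
theorem hurwitz (h : ∃ a : A, a ∉ Submodule.span F {(1 : A)}) :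
    FiniteDimensional F A ∧ (Module.finrank F A = 2 ∨
      (Module.finrank F A = 4 ∧ ∃ a u : A, linInfty (LinearMap.mul F A) {a, u} = ⊤) ∨
      (Module.finrank F A = 8 ∧ ∃ a u v : A, linInfty (LinearMap.mul F A) {a, u, v} = ⊤)) := by
  have hfin : ∀ {B : Submodule F A}, FiniteDimensional F B → B = ⊤ →
      FiniteDimensional F A ∧ Module.finrank F A = Module.finrank F B := by
    rintro B hB rfl
    exact ⟨Module.Finite.equiv (Submodule.topEquiv (R := F) (M := A)), (finrank_top F A).symm⟩
  obtain ⟨a, ha⟩ := hn.exists_four_mul_ne h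
  obtain ⟨B, hBdef⟩ : ∃ B, B = Submodule.span F ({1, a} : Set A) := ⟨_, rfl⟩
  have hB : IsRegularSubalgebra n B := hBdef ▸ hn.isRegularSubalgebra_span_pair ha
  have hB2 : Module.finrank F B = 2 := by
    have := finrank_span_eq_card (hn.linearIndependent_pair ha)
    have hr : Set.range ![1, a] = {1, a} := by simp [Set.pair_comm]
    rwa [hr, ← hBdef, Fintype.card_fin] at this
  have hBS : ∀ S : Set A, a ∈ S → B ≤ linInfty (LinearMap.mul F A) S := fun S hS ↦ by
    refine hBdef ▸ Submodule.span_le.2 ?_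
    rintro x (rfl | rfl)
    · exact lin_le_linInfty 0 (one_mem_lin_mul 0)
    · exact subset_linInfty hS
  by_cases hBt : B = ⊤
  · obtain ⟨h1, h2⟩ := hfin hB.finite hBt
    exact ⟨h1, .inl (h2.trans hB2)⟩
  obtain ⟨u, hu, hnu⟩ := hB.exists_orthogonal hn hBt
  have hC := hB.double_isRegularSubalgebra hn hu hnu
  have hC4 := hB.finrank_double hn hu hnu
  by_cases hCt : double B u = ⊤
  · obtain ⟨h1, h2⟩ := hfin hC.finite hCt
    exact ⟨h1, .inr (.inl ⟨by omega, a, u,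
      top_unique (hCt ▸ double_le_linInfty (hBS _ (by simp)) (by simp))⟩)⟩
  obtain ⟨v, hv, hnv⟩ := hC.exists_orthogonal hn hCt
  have hD := hC.double_isRegularSubalgebra hn hv hnv
  have hD8 := hC.finrank_double hn hv hnv
  by_cases hDt : double (double B u) v = ⊤
  · obtain ⟨h1, h2⟩ := hfin hD.finite hDt
    exact ⟨h1, .inr (.inr ⟨by omega, a, u, v, top_unique (hDt ▸ double_le_linInfty
      (double_le_linInfty (hBS _ (by simp)) (by simp)) (by simp))⟩)⟩
  -- otherwise the eight-dimensional subalgebra is associative, hence the four-dimensional one is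
  -- commutative, hence the involution is trivial on the two-dimensional one
  obtain ⟨w, hw, hnw⟩ := hD.exists_orthogonal hn hDt
  refine (hn.conj_ne_self ha (hB.conj_eq_of_double_comm hn hu hnu (fun x hx y hy ↦
    hC.commute_of_double_assoc hn hv hnv (fun x hx y hy z hz ↦
      hD.mul_assoc_of_orthogonal hn hw hnw hx hy hz) hx hy)
    (hBdef ▸ Submodule.subset_span (by simp)))).elim

end IsCompositionNorm

end Hurwitz

/-! ### Twisted products without unit element -/

section Twisted

variable {F A : Type*} [Field F] [NonAssocRing A] [Module F A]

/-- The properties, shared by the standard products of types II and IV, from which their lengths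
are computed. The product `m` agrees with that of `A` up to combinations of `1` and of the factors;
`Q x y` is the coefficient of `1` in `m x y + m y x`, and `q x` that in `m x x`. The last fields
say that letters isotropic for `Q` and `q` are orthogonal to certain words in them. -/
structure IsTwistedProduct (m : A →ₗ[F] A →ₗ[F] A) (Q : A →ₗ[F] A →ₗ[F] F) (q : A → F) :
    Prop where
  not_isUnitElement : ∀ f, ¬ IsUnitElement m f
  mul_mem : ∀ x y, x * y ∈ Submodule.span F {1, x, y, m x y}
  twisted_mem : ∀ x y, m x y ∈ Submodule.span F {1, x, y, x * y}
  self_mem : ∀ x, m x x - q x • 1 ∈ Submodule.span F {x}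
  add_mem : ∀ x y, m x y + m y x - Q x y • 1 ∈ Submodule.span F {x, y}
  mem_of_orthogonal : ∀ x, (∀ y, Q x y = 0) → x ∈ Submodule.span F {1}
  left_orthogonal : ∀ a b, q a = 0 → Q a b = 0 → Q a (m a b) = 0
  right_orthogonal : ∀ a b, q b = 0 → Q a b = 0 → Q b (m a b) = 0
  orthogonal_triple : ∀ a b c, (∀ x ∈ ({a, b, c} : Set A), q x = 0) →
    (∀ x ∈ ({a, b, c} : Set A), ∀ y ∈ ({a, b, c} : Set A), Q x y = 0) →
    (∀ x ∈ ({a, b, c} : Set A), ∀ y ∈ ({a, b, c} : Set A), ∀ z ∈ ({a, b, c} : Set A),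
      Q x (m y z) = 0) → Q b (m a (m b c)) = 0 ∧ Q c (m a (m b c)) = 0

lemma bilin_span_eq_zero {Q : A →ₗ[F] A →ₗ[F] F} {s t : Set A}
    (h : ∀ x ∈ s, ∀ y ∈ t, Q x y = 0) :
    ∀ x ∈ Submodule.span F s, ∀ y ∈ Submodule.span F t, Q x y = 0 := by
  intro x hx y hy
  have h1 : Submodule.span F t ≤ LinearMap.ker (Q x) := by
    refine Submodule.span_le.2 fun z hz ↦ ?_
    have h2 : Submodule.span F s ≤ LinearMap.ker (Q.flip z) :=
      Submodule.span_le.2 fun w hw ↦ h w hw z hz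
    exact h2 hx
  exact h1 hy

lemma span_eq_top_of_linearIndependent {k : ℕ} (hk : 0 < k) {v : Fin k → A}
    (h : LinearIndependent F v) (hd : Module.finrank F A = k) :
    Submodule.span F (Set.range v) = ⊤ := by
  have : Nonempty (Fin k) := ⟨⟨0, hk⟩⟩
  exact h.span_eq_top_of_card_eq_finrank (by simp [hd])

lemma finrank_span_pair_of_linearIndependent {a b c : A}
    (h : LinearIndependent F ![1, a, b, c]) : Module.finrank F (Submodule.span F {a, b}) = 2 := by
  have h2 : LinearIndependent F ![a, b] := by
    have := h.comp ![1, 2] (by decide)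
    convert this using 1
    ext i
    fin_cases i <;> rfl
  have h3 := finrank_span_eq_card h2
  have hr : Set.range ![a, b] = {a, b} := by simp [Set.pair_comm]
  rwa [hr, Fintype.card_fin] at h3

namespace IsTwistedProduct

variable [IsScalarTower F A A] [SMulCommClass F A A] {n : QuadraticForm F A}
  {m : A →ₗ[F] A →ₗ[F] A} {Q : A →ₗ[F] A →ₗ[F] F} {q : A → F} {S : Set A}
  (hm : IsTwistedProduct m Q q)
include hm

lemma linInfty_le_linInfty_mul : linInfty m S ≤ linInfty (LinearMap.mul F A) S := by
  refine linInfty_le (fun f hf ↦ (hm.not_isUnitElement f hf).elim) subset_linInfty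
    fun x hx y hy ↦ ?_
  refine Submodule.span_le.2 ?_ (hm.twisted_mem x y)
  rintro z (rfl | rfl | rfl | rfl)
  · exact lin_le_linInfty 0 (one_mem_lin_mul 0)
  · exact hx
  · exact hy
  · exact mul_mem_linInfty hx hy

lemma mul_mem_of {P : Submodule F A} {x y : A} (h1 : 1 ∈ P) (hx : x ∈ P) (hy : y ∈ P)
    (hxy : m x y ∈ P) : x * y ∈ P := by
  refine Submodule.span_le.2 ?_ (hm.mul_mem x y)
  rintro z (rfl | rfl | rfl | rfl) <;> assumption

lemma twisted_mem_of {P : Submodule F A} {x y : A} (h1 : 1 ∈ P) (hx : x ∈ P) (hy : y ∈ P)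
    (hxy : x * y ∈ P) : m x y ∈ P := by
  refine Submodule.span_le.2 ?_ (hm.twisted_mem x y)
  rintro z (rfl | rfl | rfl | rfl) <;> assumption

lemma lin_two_le_lin_mul : lin m S 2 ≤ lin (LinearMap.mul F A) S 2 := by
  refine lin_two_le (fun f hf ↦ (hm.not_isUnitElement f hf).elim)
    (fun a ha ↦ letter_mem_lin ha one_le_two) fun a ha b hb ↦ ?_
  exact hm.twisted_mem_of (one_mem_lin_mul 2) (letter_mem_lin ha one_le_two)
    (letter_mem_lin hb one_le_two) (mul_mem_lin_mul (j := 1) (k := 1) (letter_mem_lin ha le_rfl)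
      (letter_mem_lin hb le_rfl))

/-- Adjoining `1` makes up for the difference between the two products. -/
lemma lin_mul_le_sup (k : ℕ) :
    lin (LinearMap.mul F A) S k ≤ Submodule.span F {1} ⊔ lin m S k := by
  have h1 : ∀ k, (1 : A) ∈ Submodule.span F {1} ⊔ lin m S k := fun k ↦
    Submodule.mem_sup_left (Submodule.mem_span_singleton_self 1)
  refine lin_le (fun f hf ↦ isUnitElement_mul_iff.1 hf ▸ h1 k) fun j hj w hw ↦ ?_
  refine (sup_le_sup_left (lin_mono hj) _ :
    Submodule.span F {1} ⊔ lin m S j ≤ Submodule.span F {1} ⊔ lin m S k) ?_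
  clear hj
  induction hw with
  | letter h => exact Submodule.mem_sup_right (letter_mem_lin h le_rfl)
  | @mul i j _ _ _ _ ihx ihy =>
    set P := Submodule.span F {1} ⊔ lin m S (i + j) with hP
    obtain ⟨_, hs, x, hx, rfl⟩ := Submodule.mem_sup.1 ihx
    obtain ⟨_, ht, y, hy, rfl⟩ := Submodule.mem_sup.1 ihy
    obtain ⟨s, rfl⟩ := Submodule.mem_span_singleton.1 hs
    obtain ⟨t, rfl⟩ := Submodule.mem_span_singleton.1 ht
    have hxP : x ∈ P := Submodule.mem_sup_right (lin_mono (by omega) hx)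
    have hyP : y ∈ P := Submodule.mem_sup_right (lin_mono (by omega) hy)
    have hxy := hm.mul_mem_of (h1 _) hxP hyP (Submodule.mem_sup_right (mul_mem_lin hx hy))
    simp only [LinearMap.mul_apply', add_mul, mul_add, smul_mul_assoc, mul_smul_comm, one_mul,
      mul_one]
    exact P.add_mem (P.smul_mem _ (P.add_mem (P.smul_mem _ (h1 _)) hxP))
      (P.add_mem (P.smul_mem _ hyP) hxy)

/-- An isotropic space of letters without `1` is at most a line, if it is orthogonal to a
hyperplane that does not contain `1`: its elements orthogonal to `1` lie in the radical. -/
lemma finrank_le_one [FiniteDimensional F A] {V W : Submodule F A} (h1 : (1 : A) ∉ V)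
    (hW : Submodule.span F {1} ⊔ W = ⊤) (hQ : ∀ x ∈ V, ∀ y ∈ W, Q x y = 0) :
    Module.finrank F V ≤ 1 := by
  have hinj : Function.Injective ((Q.flip 1).comp V.subtype) := by
    refine (injective_iff_map_eq_zero _).2 ?_
    rintro ⟨x, hx⟩ hx1
    replace hx1 : Q x 1 = 0 := hx1
    have hxs : x ∈ Submodule.span F {1} := hm.mem_of_orthogonal x fun y ↦ by
      have hy : y ∈ Submodule.span F {1} ⊔ W := hW ▸ Submodule.mem_top
      obtain ⟨_, hs, w, hw, rfl⟩ := Submodule.mem_sup.1 hy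
      obtain ⟨s, rfl⟩ := Submodule.mem_span_singleton.1 hs
      rw [map_add, map_smul, hx1, hQ x hx w hw, smul_zero, add_zero]
    obtain ⟨s, rfl⟩ := Submodule.mem_span_singleton.1 hxs
    by_cases hs : s = 0
    · simp [hs]
    · exact (h1 ((V.smul_mem_iff hs).1 hx)).elim
  simpa using LinearMap.finrank_le_finrank_of_injective hinj

lemma isotropic_of_mem {P : Submodule F A} (h1 : (1 : A) ∉ P) {x : A} (hx : x ∈ P)
    (hxx : m x x ∈ P) : q x = 0 := by
  by_contra h
  have := (Submodule.span_singleton_le_iff_mem _ _).2 hx (hm.self_mem x)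
  exact h1 ((P.smul_mem_iff h).1 ((P.sub_mem_iff_right hxx).1 this))

lemma orthogonal_of_mem {P : Submodule F A} (h1 : (1 : A) ∉ P) {x y : A} (hx : x ∈ P) (hy : y ∈ P)
    (hxy : m x y ∈ P) (hyx : m y x ∈ P) : Q x y = 0 := by
  by_contra h
  have : m x y + m y x - Q x y • 1 ∈ P := by
    refine Submodule.span_le.2 ?_ (hm.add_mem x y)
    rintro z (rfl | rfl) <;> assumption
  exact h1 ((P.smul_mem_iff h).1 ((P.sub_mem_iff_right (P.add_mem hxy hyx)).1 this))

lemma letter_isotropic {k : ℕ} (hk : 2 ≤ k) (h1 : (1 : A) ∉ lin m S k) {a : A} (ha : a ∈ S) :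
    q a = 0 :=
  hm.isotropic_of_mem h1 (letter_mem_lin ha (by omega)) (lin_mono hk
    (mul_mem_lin (j := 1) (k := 1) (letter_mem_lin ha le_rfl) (letter_mem_lin ha le_rfl)))

lemma letters_orthogonal {k : ℕ} (hk : 2 ≤ k) (h1 : (1 : A) ∉ lin m S k) {a b : A} (ha : a ∈ S)
    (hb : b ∈ S) : Q a b = 0 :=
  hm.orthogonal_of_mem h1 (letter_mem_lin ha (by omega)) (letter_mem_lin hb (by omega))
    (lin_mono hk (mul_mem_lin (j := 1) (k := 1) (letter_mem_lin ha le_rfl)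
      (letter_mem_lin hb le_rfl)))
    (lin_mono hk (mul_mem_lin (j := 1) (k := 1) (letter_mem_lin hb le_rfl)
      (letter_mem_lin ha le_rfl)))

lemma letter_orthogonal_mul {k : ℕ} (hk : 3 ≤ k) (h1 : (1 : A) ∉ lin m S k) {a b c : A}
    (ha : a ∈ S) (hb : b ∈ S) (hc : c ∈ S) : Q a (m b c) = 0 := by
  have h := mul_mem_lin (m := m) (j := 1) (k := 1) (letter_mem_lin hb le_rfl)
    (letter_mem_lin hc le_rfl)
  exact hm.orthogonal_of_mem h1 (letter_mem_lin ha (by omega)) (lin_mono (by omega) h)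
    (lin_mono hk (mul_mem_lin (j := 1) (k := 2) (letter_mem_lin ha le_rfl) h))
    (lin_mono hk (mul_mem_lin (j := 2) (k := 1) h (letter_mem_lin ha le_rfl)))

variable [Nontrivial A] (hn : IsCompositionNorm n)
include hn

/-- In dimension four, words of length two in a generating set of `A` span `A`, for the twisted
product as well. -/
lemma lin_two_eq_top (hd : Module.finrank F A = 4)
    (hS : linInfty (LinearMap.mul F A) S = ⊤) : lin m S 2 = ⊤ := by
  have hfin : FiniteDimensional F A := Module.finite_of_finrank_pos (by omega)
  have htop : Submodule.span F {1} ⊔ lin m S 2 = ⊤ := by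
    rcases hn.lin_two_eq_top_or hS with h | ⟨a, -, b, -, c, -, h⟩
    · exact top_unique (h ▸ hm.lin_mul_le_sup 2)
    · have := h.fintype_card_le_finrank
      rw [Fintype.card_fin, hd] at this
      omega
  by_contra hne
  have h1 : (1 : A) ∉ lin m S 2 := fun h1 ↦ hne <| by
    rwa [sup_eq_right.2 ((Submodule.span_singleton_le_iff_mem _ _).2 h1)] at htop
  rcases hn.lin_one_eq_top_or hS with h | ⟨a, ha, b, hb, h⟩
  · have htop1 : Submodule.span F {1} ⊔ lin m S 1 = ⊤ := top_unique (h ▸ hm.lin_mul_le_sup 1)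
    have hle : Module.finrank F (lin m S 1) ≤ 1 := by
      refine hm.finrank_le_one (fun h ↦ h1 (lin_mono one_le_two h)) htop1 ?_
      rw [lin_one_of_forall_not_isUnitElement hm.not_isUnitElement]
      exact bilin_span_eq_zero fun x hx y hy ↦ hm.letters_orthogonal le_rfl h1 hx hy
    have h2 := Submodule.finrank_add_le_finrank_add_finrank (Submodule.span F {(1 : A)})
      (lin m S 1)
    rw [htop1, finrank_top, hd, finrank_span_singleton one_ne_zero] at h2
    omega
  · have hPle : ({a, b, m a b} : Set A) ⊆ lin m S 2 := by
      rintro z (rfl | rfl | rfl)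
      · exact letter_mem_lin ha one_le_two
      · exact letter_mem_lin hb one_le_two
      · exact mul_mem_lin (j := 1) (k := 1) (letter_mem_lin ha le_rfl) (letter_mem_lin hb le_rfl)
    have hP : Submodule.span F {1} ⊔ Submodule.span F {a, b, m a b} = ⊤ := by
      rw [← Submodule.span_union, Set.singleton_union]
      refine top_unique (span_eq_top_of_linearIndependent (by norm_num) h hd ▸
        Submodule.span_le.2 (Set.range_subset_iff.2 ?_))
      have hsub := Submodule.subset_span (R := F) (s := {1, a, b, m a b})
      simp only [Fin.forall_fin_succ, IsEmpty.forall_iff, and_true]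
      exact ⟨hsub (by simp), hsub (by simp), hsub (by simp),
        hm.mul_mem_of (hsub (by simp)) (hsub (by simp)) (hsub (by simp)) (hsub (by simp))⟩
    have hqa := hm.letter_isotropic le_rfl h1 ha
    have hqb := hm.letter_isotropic le_rfl h1 hb
    have hQ : ∀ {x y}, x ∈ S → y ∈ S → Q x y = 0 := hm.letters_orthogonal le_rfl h1
    have hle := hm.finrank_le_one (V := Submodule.span F {a, b})
      (fun h ↦ h1 (Submodule.span_le.2 ((by simp [Set.insert_subset_iff] :
        ({a, b} : Set A) ⊆ {a, b, m a b}).trans hPle) h)) hP <| by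
      refine bilin_span_eq_zero ?_
      rintro x (rfl | rfl) y (rfl | rfl | rfl)
      · exact hQ ha ha
      · exact hQ ha hb
      · exact hm.left_orthogonal _ _ hqa (hQ ha hb)
      · exact hQ hb ha
      · exact hQ hb hb
      · exact hm.right_orthogonal _ _ hqb (hQ ha hb)
    rw [finrank_span_pair_of_linearIndependent h] at hle
    omega

/-- In dimension eight, words of length three in a generating set of `A` span `A`, for the twisted
product as well. -/
lemma lin_three_eq_top (hd : Module.finrank F A = 8)
    (hS : linInfty (LinearMap.mul F A) S = ⊤) : lin m S 3 = ⊤ := by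
  have hfin : FiniteDimensional F A := Module.finite_of_finrank_pos (by omega)
  by_contra hne
  have h1 : Submodule.span F {1} ⊔ lin m S 3 = ⊤ → (1 : A) ∉ lin m S 3 := fun htop h1 ↦ hne <| by
    rwa [sup_eq_right.2 ((Submodule.span_singleton_le_iff_mem _ _).2 h1)] at htop
  rcases hn.lin_two_eq_top_or hS with h | ⟨a, ha, b, hb, c, hc, h⟩
  · have htop : Submodule.span F {1} ⊔ lin m S 2 = ⊤ := top_unique (h ▸ hm.lin_mul_le_sup 2)
    replace h1 := h1 (top_unique (htop ▸ sup_le_sup_left (lin_mono (by norm_num)) _))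
    have hle : Module.finrank F (lin m S 1) ≤ 1 := by
      refine hm.finrank_le_one (fun h ↦ h1 (lin_mono (by norm_num) h)) htop fun x hx y hy ↦ ?_
      have hlt : ∀ a ∈ S, lin m S 2 ≤ LinearMap.ker (Q a) := fun a ha ↦
        lin_two_le (fun f hf ↦ (hm.not_isUnitElement f hf).elim)
          (fun b hb ↦ hm.letters_orthogonal (by norm_num) h1 ha hb)
          fun b hb c hc ↦ hm.letter_orthogonal_mul le_rfl h1 ha hb hc
      have : lin m S 1 ≤ LinearMap.ker (Q.flip y) :=
        lin_one_le (fun f hf ↦ (hm.not_isUnitElement f hf).elim) fun a ha ↦ hlt a ha hy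
      exact this hx
    rcases hn.lin_one_eq_top_or hS with h' | ⟨a, ha, b, hb, h'⟩
    · have htop1 : Submodule.span F {1} ⊔ lin m S 1 = ⊤ :=
        top_unique (h' ▸ hm.lin_mul_le_sup 1)
      have h2 := Submodule.finrank_add_le_finrank_add_finrank (Submodule.span F {(1 : A)})
        (lin m S 1)
      rw [htop1, finrank_top, hd, finrank_span_singleton one_ne_zero] at h2
      omega
    · have hsub : Submodule.span F {a, b} ≤ lin m S 1 := by
        refine Submodule.span_le.2 ?_
        rintro z (rfl | rfl)
        · exact letter_mem_lin ha le_rfl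
        · exact letter_mem_lin hb le_rfl
      have := Submodule.finrank_mono hsub
      rw [finrank_span_pair_of_linearIndependent h'] at this
      omega
  · have hsub : ∀ x ∈ ({a, b, c} : Set A), x ∈ S := by
      rintro x (rfl | rfl | rfl) <;> assumption
    have hS2 : ∀ {x y}, x ∈ S → y ∈ S → m x y ∈ lin m S 2 := fun hx hy ↦
      mul_mem_lin (j := 1) (k := 1) (letter_mem_lin hx le_rfl) (letter_mem_lin hy le_rfl)
    have hW : Submodule.span F {a, b, c, m a b, m a c, m b c, m a (m b c)} ≤ lin m S 3 := by
      refine Submodule.span_le.2 ?_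
      rintro z (rfl | rfl | rfl | rfl | rfl | rfl | rfl)
      · exact letter_mem_lin ha (by norm_num)
      · exact letter_mem_lin hb (by norm_num)
      · exact letter_mem_lin hc (by norm_num)
      · exact lin_mono (by norm_num) (hS2 ha hb)
      · exact lin_mono (by norm_num) (hS2 ha hc)
      · exact lin_mono (by norm_num) (hS2 hb hc)
      · exact mul_mem_lin (j := 1) (k := 2) (letter_mem_lin ha le_rfl) (hS2 hb hc)
    have hP : Submodule.span F {1} ⊔
        Submodule.span F {a, b, c, m a b, m a c, m b c, m a (m b c)} = ⊤ := by
      rw [← Submodule.span_union, Set.singleton_union]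
      refine top_unique (span_eq_top_of_linearIndependent (by norm_num) h hd ▸
        Submodule.span_le.2 (Set.range_subset_iff.2 ?_))
      have hs := Submodule.subset_span (R := F)
        (s := {1, a, b, c, m a b, m a c, m b c, m a (m b c)})
      set P := Submodule.span F {1, a, b, c, m a b, m a c, m b c, m a (m b c)} with hPdef
      have p1 : (1 : A) ∈ P := hs (by simp)
      have pa : a ∈ P := hs (by simp)
      have pb : b ∈ P := hs (by simp)
      have pc : c ∈ P := hs (by simp)
      have pab : a * b ∈ P := hm.mul_mem_of p1 pa pb (hs (by simp))
      have pac : a * c ∈ P := hm.mul_mem_of p1 pa pc (hs (by simp))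
      have pbc : b * c ∈ P := hm.mul_mem_of p1 pb pc (hs (by simp))
      have pabc : a * (b * c) ∈ P := by
        have : Submodule.span F {1, b, c, m b c} ≤ P.comap (LinearMap.mul F A a) := by
          refine Submodule.span_le.2 ?_
          rintro z (rfl | rfl | rfl | rfl)
          · simpa using pa
          · exact pab
          · exact pac
          · exact hm.mul_mem_of p1 pa (hs (by simp)) (hs (by simp))
        exact this (hm.mul_mem b c)
      simp only [Fin.forall_fin_succ, IsEmpty.forall_iff, and_true]
      exact ⟨p1, pa, pb, pc, pab, pac, pbc, pabc⟩
    replace h1 := h1 (top_unique (hP ▸ sup_le_sup_left hW _))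
    have hV : Submodule.span F {a, b, c} ≤
        Submodule.span F {a, b, c, m a b, m a c, m b c, m a (m b c)} :=
      Submodule.span_mono (by simp [Set.insert_subset_iff])
    have hq : ∀ x ∈ ({a, b, c} : Set A), q x = 0 := fun x hx ↦
      hm.letter_isotropic (by norm_num) h1 (hsub x hx)
    have hQ : ∀ x ∈ ({a, b, c} : Set A), ∀ y ∈ ({a, b, c} : Set A), Q x y = 0 := fun x hx y hy ↦
      hm.letters_orthogonal (by norm_num) h1 (hsub x hx) (hsub y hy)
    have hQ3 : ∀ x ∈ ({a, b, c} : Set A), ∀ y ∈ ({a, b, c} : Set A), ∀ z ∈ ({a, b, c} : Set A),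
        Q x (m y z) = 0 := fun x hx y hy z hz ↦
      hm.letter_orthogonal_mul le_rfl h1 (hsub x hx) (hsub y hy) (hsub z hz)
    have ia : a ∈ ({a, b, c} : Set A) := by simp
    have ib : b ∈ ({a, b, c} : Set A) := by simp
    have ic : c ∈ ({a, b, c} : Set A) := by simp
    have hw : ∀ x ∈ ({a, b, c} : Set A), Q x (m a (m b c)) = 0 := by
      obtain ⟨h2, h3⟩ := hm.orthogonal_triple a b c hq hQ hQ3
      have h4 := hm.left_orthogonal a (m b c) (hq a ia) (hQ3 a ia b ib c ic)
      rintro x (rfl | rfl | rfl) <;> assumption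
    have hle := hm.finrank_le_one (fun h ↦ h1 (hW (hV h))) hP <| by
      refine bilin_span_eq_zero fun x hx ↦ ?_
      rintro y (rfl | rfl | rfl | rfl | rfl | rfl | rfl)
      · exact hQ x hx _ ia
      · exact hQ x hx _ ib
      · exact hQ x hx _ ic
      · exact hQ3 x hx _ ia _ ib
      · exact hQ3 x hx _ ia _ ic
      · exact hQ3 x hx _ ib _ ic
      · exact hw x hx
    have h2 : LinearIndependent F ![1, a, b, c] := by
      have := h.comp ![0, 1, 2, 3] (by decide)
      convert this using 1
      ext i
      fin_cases i <;> rfl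
    have h3 := finrank_span_pair_of_linearIndependent h2
    have h4 := Submodule.finrank_mono (Submodule.span_mono (R := F)
      (by simp [Set.insert_subset_iff] : ({a, b} : Set A) ⊆ {a, b, c}))
    omega

end IsTwistedProduct

end Twisted

/-! ### The standard products of types II and IV -/

section Standard

variable {F A : Type*} [Field F] [NonAssocRing A] [Module F A]
  [IsScalarTower F A A] [SMulCommClass F A A] {n : QuadraticForm F A}

@[simp] lemma standardMul_I (n : QuadraticForm F A) : standardMul n .I = LinearMap.mul F A := rfl

lemma standardMul_II_apply (n : QuadraticForm F A) (a b : A) :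
    standardMul n .II a b = conj n a * b := rfl

lemma standardMul_III_apply (n : QuadraticForm F A) (a b : A) :
    standardMul n .III a b = a * conj n b := rfl

lemma standardMul_IV_apply (n : QuadraticForm F A) (a b : A) :
    standardMul n .IV a b = conj n a * conj n b := rfl

lemma standardMul_II_eq (n : QuadraticForm F A) (a b : A) :
    standardMul n .II a b = polar n a 1 • b - a * b := by
  rw [standardMul_II_apply, conj_apply, sub_mul, smul_mul_assoc, one_mul]

lemma standardMul_IV_eq (n : QuadraticForm F A) (a b : A) :
    standardMul n .IV a b =
      (polar n a 1 * polar n b 1) • 1 - polar n a 1 • b - polar n b 1 • a + a * b := by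
  rw [standardMul_IV_apply, conj_apply, conj_apply, sub_mul, mul_sub, mul_sub, smul_mul_assoc,
    one_mul, smul_mul_assoc, one_mul, mul_smul_comm, mul_one]
  module

variable [Nontrivial A] (hn : IsCompositionNorm n)
include hn

namespace IsCompositionNorm

/-- Conjugation turns a product of type III into the opposite of one of type II. -/
lemma algLength_III : algLength (standardMul n .III) = algLength (standardMul n .II) := by
  refine algLength_eq_of_antiisomorphism
    (LinearEquiv.ofInvolutive (conj n) hn.conj_conj) fun a b ↦ ?_
  change conj n (a * conj n b) = conj n (conj n b) * conj n a
  rw [hn.conj_mul]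

lemma not_isUnitElement_II (h : ∃ a : A, a ∉ Submodule.span F {(1 : A)}) (f : A) :
    ¬ IsUnitElement (standardMul n .II) f := by
  intro hf
  have h1 := (hf 1).2
  rw [standardMul_II_apply, hn.conj_one, one_mul] at h1
  obtain ⟨a, ha⟩ := hn.exists_conj_ne h
  have h2 := (hf a).2
  rw [standardMul_II_apply, h1, mul_one] at h2
  exact ha h2

lemma not_isUnitElement_IV (h : ∃ a : A, a ∉ Submodule.span F {(1 : A)}) (f : A) :
    ¬ IsUnitElement (standardMul n .IV) f := by
  intro hf
  have h1 := (hf 1).2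
  rw [standardMul_IV_apply, hn.conj_one, one_mul] at h1
  obtain ⟨a, ha⟩ := hn.exists_conj_ne h
  have h2 := (hf a).2
  rw [standardMul_IV_apply, h1, mul_one] at h2
  exact ha h2

lemma standardMul_II_self (a : A) : standardMul n .II a a = n a • 1 := hn.conj_mul_self a

lemma standardMul_IV_self (a : A) : standardMul n .IV a a =
    (polar n a 1 * polar n a 1 - n a) • 1 - polar n a 1 • a := by
  rw [standardMul_IV_eq, hn.mul_self_eq]
  module

lemma isTwistedProduct_II (h : ∃ a : A, a ∉ Submodule.span F {(1 : A)}) :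
    IsTwistedProduct (standardMul n .II) n.polarBilin n where
  not_isUnitElement := hn.not_isUnitElement_II h
  mul_mem x y := by
    have hs := Submodule.subset_span (R := F) (s := {1, x, y, standardMul n .II x y})
    have e : x * y = polar n x 1 • y - standardMul n .II x y := by
      rw [standardMul_II_eq]
      module
    rw [e]
    exact sub_mem (Submodule.smul_mem _ _ (hs (by simp))) (hs (by simp))
  twisted_mem x y := by
    have hs := Submodule.subset_span (R := F) (s := {1, x, y, x * y})
    rw [standardMul_II_eq]
    exact sub_mem (Submodule.smul_mem _ _ (hs (by simp))) (hs (by simp))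
  self_mem x := by
    rw [hn.standardMul_II_self, sub_self]
    exact zero_mem _
  add_mem x y := by
    rw [standardMul_II_apply, standardMul_II_apply, hn.conj_mul_add,
      QuadraticMap.polarBilin_apply_apply, sub_self]
    exact zero_mem _
  mem_of_orthogonal x hx := by
    rw [hn.nondegenerate.1 x hx]
    exact zero_mem _
  left_orthogonal a b ha hab := by
    simp only [QuadraticMap.polarBilin_apply_apply] at hab ⊢
    rw [standardMul_II_apply, ← hn.polar_mul_eq_left, hn.mul_self_eq, ha, zero_smul, sub_zero,
      QuadraticMap.polar_smul_left, hab, smul_zero]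
  right_orthogonal a b hb _ := by
    have h1 := hn.polar_mul_right 1 (conj n a) b
    rw [one_mul, hb, mul_zero] at h1
    exact h1
  orthogonal_triple a b c hq hQ hQ3 := by
    simp only [QuadraticMap.polarBilin_apply_apply, standardMul_II_apply] at hQ hQ3 ⊢
    rw [← hn.polar_mul_eq_left a b, ← hn.polar_mul_eq_left a c]
    have hb := hq b (by simp)
    have hc := hq c (by simp)
    have hab := hQ a (by simp) b (by simp)
    have hbc := hQ b (by simp) c (by simp)
    have h1 : polar n (a * c) b = 0 := by
      rw [hn.polar_mul_eq_left, QuadraticMap.polar_comm, QuadraticMap.polar_comm,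
        hQ3 c (by simp) a (by simp) b (by simp)]
    have h2 : polar n (a * b) c = 0 := by
      rw [hn.polar_mul_eq_left, hQ3 b (by simp) a (by simp) c (by simp)]
    refine ⟨?_, ?_⟩
    · have h3 := hn.polar_mul_add_polar_mul a b b c
      rw [hab, hn.mul_self_eq b, hb, zero_smul, sub_zero, QuadraticMap.polar_smul_right, h1,
        smul_zero, add_zero, zero_mul] at h3
      rw [conj_apply, sub_mul, smul_mul_assoc, one_mul, QuadraticMap.polar_sub_right,
        QuadraticMap.polar_smul_right, h2, h3, smul_zero, sub_zero]
    · rw [hn.polar_mul_right, hc, mul_zero]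

/-- The bilinear form attached to the product of type IV, the polar form of `t(x)² - n(x)`, where
`t(x) = n(x, 1)` is the trace. -/
def traceForm (n : QuadraticForm F A) : A →ₗ[F] A →ₗ[F] F :=
  (2 : F) • (LinearMap.mul F F).compl₁₂ (n.polarBilin.flip 1) (n.polarBilin.flip 1) - n.polarBilin

omit hn [Nontrivial A] [IsScalarTower F A A] [SMulCommClass F A A] in
lemma traceForm_apply (n : QuadraticForm F A) (x y : A) :
    traceForm n x y = 2 * (polar n x 1 * polar n y 1) - polar n x y := rfl

lemma isTwistedProduct_IV (h : ∃ a : A, a ∉ Submodule.span F {(1 : A)}) :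
    IsTwistedProduct (standardMul n .IV) (traceForm n)
      (fun x ↦ polar n x 1 * polar n x 1 - n x) where
  not_isUnitElement := hn.not_isUnitElement_IV h
  mul_mem x y := by
    have hs := Submodule.subset_span (R := F) (s := {1, x, y, standardMul n .IV x y})
    have e : x * y = standardMul n .IV x y - (polar n x 1 * polar n y 1) • (1 : A) +
        polar n x 1 • y + polar n y 1 • x := by
      rw [standardMul_IV_eq]
      module
    rw [e]
    exact add_mem (add_mem (sub_mem (hs (by simp)) (Submodule.smul_mem _ _ (hs (by simp))))
      (Submodule.smul_mem _ _ (hs (by simp)))) (Submodule.smul_mem _ _ (hs (by simp)))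
  twisted_mem x y := by
    have hs := Submodule.subset_span (R := F) (s := {1, x, y, x * y})
    rw [standardMul_IV_eq]
    exact add_mem (sub_mem (sub_mem (Submodule.smul_mem _ _ (hs (by simp)))
      (Submodule.smul_mem _ _ (hs (by simp)))) (Submodule.smul_mem _ _ (hs (by simp))))
      (hs (by simp))
  self_mem x := by
    rw [hn.standardMul_IV_self]
    exact Submodule.mem_span_singleton.2 ⟨-polar n x 1, by module⟩
  add_mem x y := by
    refine Submodule.mem_span_pair.2 ⟨-polar n y 1, -polar n x 1, ?_⟩
    rw [standardMul_IV_eq, standardMul_IV_eq, traceForm_apply]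
    linear_combination (norm := module) -hn.mul_add_mul x y
  mem_of_orthogonal x hx := by
    refine Submodule.mem_span_singleton.2 ⟨2 * polar n x 1, hn.eq_of_polar fun z ↦ ?_⟩
    have := hx z
    rw [traceForm_apply] at this
    rw [QuadraticMap.polar_smul_left, QuadraticMap.polar_comm n 1, smul_eq_mul]
    linear_combination this
  left_orthogonal a b ha hab := by
    rw [traceForm_apply] at hab ⊢
    have h1 : polar n a (conj n a * conj n b) = polar n (a * a) (conj n b) :=
      (hn.polar_mul_eq_left _ _ _).symm
    rw [standardMul_IV_apply, h1, ← hn.conj_mul, hn.polar_conj_one, hn.polar_mul_one,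
      hn.mul_self_eq, QuadraticMap.polar_sub_left, QuadraticMap.polar_smul_left,
      QuadraticMap.polar_smul_left, QuadraticMap.polar_comm n 1, hn.polar_conj_one, conj_apply,
      QuadraticMap.polar_sub_right, QuadraticMap.polar_smul_right, smul_eq_mul, smul_eq_mul,
      smul_eq_mul, QuadraticMap.polar_comm n b a]
    linear_combination polar n a 1 * hab - polar n b 1 * ha
  right_orthogonal a b hb hab := by
    rw [traceForm_apply] at hab ⊢
    have h1 : polar n b (conj n a * conj n b) = polar n (b * b) (conj n a) := by
      rw [hn.polar_mul_eq_right]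
    rw [standardMul_IV_apply, h1, ← hn.conj_mul, hn.polar_conj_one, hn.polar_mul_one,
      hn.mul_self_eq, QuadraticMap.polar_sub_left, QuadraticMap.polar_smul_left,
      QuadraticMap.polar_smul_left, QuadraticMap.polar_comm n 1, hn.polar_conj_one, conj_apply,
      QuadraticMap.polar_sub_right, QuadraticMap.polar_smul_right, smul_eq_mul, smul_eq_mul,
      smul_eq_mul, QuadraticMap.polar_comm n b a]
    linear_combination polar n b 1 * hab - polar n a 1 * hb
  orthogonal_triple a b c hq hQ hQ3 := by
    have hpc : ∀ x y, polar n x (conj n y) = polar n x 1 * polar n y 1 - polar n x y :=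
      fun x y ↦ by
        rw [conj_apply, QuadraticMap.polar_sub_right, QuadraticMap.polar_smul_right, smul_eq_mul,
          mul_comm]
    have hm : ∀ x y, standardMul n .IV x y = conj n (y * x) := fun x y ↦ by
      rw [standardMul_IV_apply, hn.conj_mul]
    have hw : standardMul n .IV a (standardMul n .IV b c) = conj n a * (c * b) := by
      rw [hm b c, standardMul_IV_apply, hn.conj_conj]
    have ht : polar n (conj n a * (c * b)) 1 = polar n a (c * b) := by
      rw [QuadraticMap.polar_comm, ← hn.polar_mul_eq_left, mul_one]
    have hb : n b = polar n b 1 * polar n b 1 := (sub_eq_zero.1 (hq b (by simp))).symm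
    have hc : n c = polar n c 1 * polar n c 1 := (sub_eq_zero.1 (hq c (by simp))).symm
    have hpQ : ∀ x ∈ ({a, b, c} : Set A), ∀ y ∈ ({a, b, c} : Set A),
        polar n x y = 2 * (polar n x 1 * polar n y 1) := fun x hx y hy ↦
      (sub_eq_zero.1 (hQ x hx y hy)).symm
    have hab := hpQ a (by simp) b (by simp)
    have hac := hpQ a (by simp) c (by simp)
    have hcb := hpQ c (by simp) b (by simp)
    have hu := hQ3 a (by simp) b (by simp) c (by simp)
    have hv := hQ3 c (by simp) b (by simp) a (by simp)
    rw [traceForm_apply, hm, hpc, hn.polar_conj_one, hn.polar_mul_one] at hu hv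
    rw [hw, traceForm_apply, traceForm_apply, ht, ← hn.polar_mul_eq_left, ← hn.polar_mul_eq_left]
    have h3 := hn.polar_mul_add_polar_mul a c c b
    rw [hn.mul_self_eq c, QuadraticMap.polar_sub_right, QuadraticMap.polar_smul_right,
      QuadraticMap.polar_smul_right, hn.polar_mul_one, smul_eq_mul, smul_eq_mul,
      QuadraticMap.polar_comm n (a * b) c] at h3
    rw [hn.polar_mul_right]
    rw [hcb] at hu
    rw [hab] at hv
    rw [hab, hac, hcb, hc] at h3
    rw [hac, hb]
    refine ⟨?_, ?_⟩
    · linear_combination 2 * polar n b 1 * hu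
    · linear_combination 2 * polar n c 1 * hu - h3 + polar n c 1 * hv

end IsCompositionNorm

end Standard

/-! ### Two-dimensional algebras without unit element -/

section TwoDimensional

variable {F A : Type*} [Field F] [AddCommGroup A] [Module F A] {m : A →ₗ[F] A →ₗ[F] A} {S : Set A}

lemma lin_one_eq_top_or_eq_span (hu : ∀ f, ¬ IsUnitElement m f) (hd : Module.finrank F A = 2)
    (hS : linInfty m S = ⊤) :
    lin m S 1 = ⊤ ∨ ∃ a, lin m S 1 = Submodule.span F {a} ∧ m a a ∉ Submodule.span F {a} := by
  have hfin : FiniteDimensional F A := Module.finite_of_finrank_pos (by omega)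
  rcases (Submodule.finrank_le (lin m S 1)).eq_or_lt with h | h
  · exact .inl (Submodule.eq_top_of_finrank_eq h)
  rw [hd, Nat.lt_succ_iff, finrank_le_one_iff] at h
  obtain ⟨⟨a, ha⟩, h⟩ := h
  have hspan : lin m S 1 = Submodule.span F {a} := by
    refine le_antisymm (fun x hx ↦ ?_) ((Submodule.span_singleton_le_iff_mem _ _).2 ha)
    obtain ⟨c, hc⟩ := h ⟨x, hx⟩
    exact Submodule.mem_span_singleton.2 ⟨c, congrArg Subtype.val hc⟩
  refine .inr ⟨a, hspan, fun hmem ↦ ?_⟩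
  have hle : linInfty m S ≤ Submodule.span F {a} := by
    refine linInfty_le (fun f hf ↦ (hu f hf).elim)
      (fun x hx ↦ hspan ▸ letter_mem_lin hx le_rfl) fun x hx y hy ↦ ?_
    obtain ⟨c, rfl⟩ := Submodule.mem_span_singleton.1 hx
    obtain ⟨d, rfl⟩ := Submodule.mem_span_singleton.1 hy
    rw [map_smul, map_smul, LinearMap.smul_apply]
    exact Submodule.smul_mem _ _ (Submodule.smul_mem _ _ hmem)
  have := Submodule.finrank_mono hle
  rw [hS, finrank_top, hd] at this
  have h1 := finrank_span_le_card (R := F) ({a} : Set A)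
  simp only [Set.toFinset_singleton, Finset.card_singleton] at h1
  omega

lemma span_pair_eq_top {a b : A} (hd : Module.finrank F A = 2) (ha : a ≠ 0)
    (hb : b ∉ Submodule.span F {a}) : Submodule.span F {a, b} = ⊤ := by
  have hli : LinearIndependent F ![a, b] := (LinearIndependent.pair_iff' ha).2 fun c hc ↦
    hb (Submodule.mem_span_singleton.2 ⟨c, hc⟩)
  have h := hli.span_eq_top_of_card_eq_finrank (by simp [hd])
  have hr : Set.range ![a, b] = {a, b} := by simp [Set.pair_comm]
  rwa [hr] at h

lemma algLength_eq_two (hu : ∀ f, ¬ IsUnitElement m f) (hd : Module.finrank F A = 2)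
    (h : ∃ a, m a a ∉ Submodule.span F {a}) : algLength m = (2 : ℕ) := by
  have hfin : FiniteDimensional F A := Module.finite_of_finrank_pos (by omega)
  have key : ∀ {S : Set A} {a}, a ∈ lin m S 1 → m a a ∉ Submodule.span F {a} →
      lin m S 2 = ⊤ := fun {S a} ha hm ↦ by
    have ha0 : a ≠ 0 := by
      rintro rfl
      simp at hm
    refine top_unique ((span_pair_eq_top hd ha0 hm).symm.le.trans (Submodule.span_le.2 ?_))
    rintro z (rfl | rfl)
    · exact lin_mono one_le_two ha
    · exact mul_mem_lin (j := 1) (k := 1) ha ha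
  obtain ⟨a, ha⟩ := h
  rw [show (2 : ℕ) = 1 + 1 from rfl]
  refine algLength_eq_succ (k := 1) (S := {a}) (fun S hS ↦ ?_)
    (linInfty_eq_top_of_lin (key (letter_mem_lin (Set.mem_singleton a) le_rfl) ha)) fun h1 ↦ ?_
  · rcases lin_one_eq_top_or_eq_span hu hd hS with h1 | ⟨b, hb, hm⟩
    · exact top_unique (h1.symm.le.trans (lin_mono one_le_two))
    · exact key (a := b) (by rw [hb]; exact Submodule.mem_span_singleton_self b) hm
  · rw [lin_one_of_forall_not_isUnitElement hu] at h1
    exact ha (h1 ▸ Submodule.mem_top)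

lemma algLength_eq_one (hu : ∀ f, ¬ IsUnitElement m f) (hd : Module.finrank F A = 2)
    (h : ∀ a, m a a ∈ Submodule.span F {a}) : algLength m = (1 : ℕ) := by
  have hnt : Nontrivial A := Module.nontrivial_of_finrank_pos (R := F) (by omega)
  refine algLength_eq_succ (k := 0) (fun S hS ↦ ?_) linInfty_univ ?_
  · rcases lin_one_eq_top_or_eq_span hu hd hS with h1 | ⟨b, -, hm⟩
    · exact h1
    · exact (hm (h b)).elim
  · rw [lin_zero_of_forall_not_isUnitElement hu]
    exact bot_ne_top

end TwoDimensional

/-! ### The algebras `K(μ)` over the field with two elements -/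

section Exceptional

variable {F A : Type*} [Field F] [NonAssocRing A] [Module F A]

lemma IsK.finrank_eq_two {μ : F} (h : IsK A μ) : Module.finrank F A = 2 := by
  obtain ⟨φ, -⟩ := h
  rw [φ.finrank_eq, QuadraticAlgebra.finrank_eq_two]

variable [IsScalarTower F A A] [SMulCommClass F A A]

lemma isK_of_mul_self [Nontrivial A] (hd : Module.finrank F A = 2) {b : A} {μ : F}
    (hb : b ∉ Submodule.span F {(1 : A)}) (hbb : b * b = b + μ • 1) : IsK A μ := by
  have hfin : FiniteDimensional F A := Module.finite_of_finrank_pos (by omega)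
  let ψ : QuadraticAlgebra F μ 1 →ₗ[F] A :=
    (QuadraticAlgebra.reₗ μ 1).smulRight 1 + (QuadraticAlgebra.imₗ μ 1).smulRight b
  have hψ : ∀ z, ψ z = z.re • 1 + z.im • b := fun z ↦ rfl
  have hmul : ∀ x y, ψ (x * y) = ψ x * ψ y := fun x y ↦ by
    simp only [hψ, QuadraticAlgebra.re_mul, QuadraticAlgebra.im_mul, add_mul, mul_add,
      smul_mul_assoc, mul_smul_comm, one_mul, mul_one, hbb]
    module
  have hsurj : Function.Surjective ψ := by
    rw [← LinearMap.range_eq_top]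
    refine top_unique (span_pair_eq_top hd one_ne_zero hb ▸ Submodule.span_le.2 ?_)
    rintro z (rfl | rfl)
    · exact ⟨⟨1, 0⟩, by simp [hψ]⟩
    · exact ⟨⟨0, 1⟩, by simp [hψ]⟩
  have hinj : Function.Injective ψ := (LinearMap.injective_iff_surjective_of_finrank_eq_finrank
    (by rw [hd, QuadraticAlgebra.finrank_eq_two])).2 hsurj
  let e := LinearEquiv.ofBijective ψ ⟨hinj, hsurj⟩
  refine ⟨e.symm, fun a b ↦ ?_⟩
  rw [LinearEquiv.symm_apply_eq]
  change _ = ψ _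
  rw [hmul]
  exact congrArg₂ _ (e.apply_symm_apply a).symm (e.apply_symm_apply b).symm

lemma eq_zero_or_eq_one_of_card (h : Nat.card F = 2) (x : F) : x = 0 ∨ x = 1 := by
  obtain ⟨y, -, hy⟩ := (Nat.card_eq_two_iff' (0 : F)).1 h
  by_cases hx : x = 0
  · exact .inl hx
  · exact .inr ((hy x hx).trans (hy 1 one_ne_zero).symm)

lemma card_eq_two_of_mul_self (h : ∀ s : F, s * s = s) : Nat.card F = 2 := by
  refine Nat.card_eq_two_iff.2 ⟨0, 1, zero_ne_one, Set.eq_univ_of_forall fun s ↦ ?_⟩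
  by_cases hs : s = 0
  · exact .inl hs
  · exact .inr (mul_left_cancel₀ hs ((h s).trans (mul_one s).symm))

lemma IsK.exists_mul_self {μ : F} (h : IsK A μ) (hF : Nat.card F = 2) (a : A) :
    ∃ y : F, a * a = a + (μ * y) • (1 : A) ∧ (y = 0 → a ∈ Submodule.span F {(1 : A)}) := by
  obtain ⟨φ, hφ⟩ := h
  have h1 : φ 1 = 1 := by
    have := hφ 1 (φ.symm 1)
    rwa [one_mul, LinearEquiv.apply_symm_apply, mul_one, eq_comm] at this
  have hid : ∀ x : F, x * x = x := fun x ↦ by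
    rcases eq_zero_or_eq_one_of_card hF x with rfl | rfl <;> simp
  have h2 : (2 : F) = 0 := by
    have := hid 2
    linear_combination this
  refine ⟨(φ a).im, φ.injective ?_, fun h0 ↦ Submodule.mem_span_singleton.2 ⟨(φ a).re,
    φ.injective ?_⟩⟩
  · rw [hφ, map_add, map_smul, h1]
    ext
    · simp only [QuadraticAlgebra.re_mul, QuadraticAlgebra.re_add, QuadraticAlgebra.re_smul,
        QuadraticAlgebra.re_one, smul_eq_mul]
      linear_combination hid (φ a).re + μ * hid (φ a).im
    · simp only [QuadraticAlgebra.im_mul, QuadraticAlgebra.im_add, QuadraticAlgebra.im_smul,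
        QuadraticAlgebra.im_one, smul_eq_mul]
      linear_combination (φ a).re * (φ a).im * h2 + hid (φ a).im
  · rw [map_smul, h1]
    ext
    · simp [QuadraticAlgebra.re_one]
    · simp [QuadraticAlgebra.im_one, h0]

variable {n : QuadraticForm F A} [Nontrivial A] (hn : IsCompositionNorm n)
include hn

namespace IsCompositionNorm

/-- If `b` is not a scalar and all products `m a a` with `a` in `b + F` are multiples of `a`, then
the coefficients of `1` in them vanish. -/
lemma self_coeff_eq_zero {m : A →ₗ[F] A →ₗ[F] A} {Q : A →ₗ[F] A →ₗ[F] F} {q : A → F}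
    (hm : IsTwistedProduct m Q q) (h : ∀ a, m a a ∈ Submodule.span F {a}) {b : A}
    (hb : b ∉ Submodule.span F {(1 : A)}) (s : F) : q (b + s • 1) = 0 := by
  have hbs : b + s • 1 ∉ Submodule.span F {(1 : A)} := fun hmem ↦ hb
    (((Submodule.span F {(1 : A)}).add_mem_iff_left
      (Submodule.smul_mem _ s (Submodule.mem_span_singleton_self 1))).1 hmem)
  refine hm.isotropic_of_mem (P := Submodule.span F {b + s • 1}) (fun h1 ↦ ?_)
    (Submodule.mem_span_singleton_self _) (h _)
  obtain ⟨c, hc⟩ := Submodule.mem_span_singleton.1 h1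
  have hc0 : c ≠ 0 := by
    rintro rfl
    simp at hc
  refine hbs (Submodule.mem_span_singleton.2 ⟨c⁻¹, ?_⟩)
  rw [inv_smul_eq_iff₀ hc0, hc]

lemma norm_add_smul_one (b : A) (s : F) :
    n (b + s • 1) = n b + s * polar n b 1 + s * s := by
  have h : n (b + s • 1) = n b + n (s • 1) + polar n b (s • 1) := QuadraticMap.map_add n b _
  rw [h, QuadraticMap.map_smul, hn.map_one, QuadraticMap.polar_smul_right, smul_eq_mul,
    smul_eq_mul]
  ring

lemma notMem_span_one {a : A} (ha : 4 * n a ≠ polar n a 1 * polar n a 1) :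
    a ∉ Submodule.span F {(1 : A)} := fun h ↦ by
  obtain ⟨c, hc⟩ := Submodule.mem_span_singleton.1 h
  exact (LinearIndependent.pair_iff' one_ne_zero).1 (hn.linearIndependent_pair ha) c hc

/-- In dimension two, all squares for the product of type II are multiples of their base exactly
for the algebra `K(0)` over the field with two elements. -/
lemma forall_self_mem_II_iff (hd : Module.finrank F A = 2)
    (h : ∃ a : A, a ∉ Submodule.span F {(1 : A)}) :
    (∀ a, standardMul n .II a a ∈ Submodule.span F {a}) ↔ Nat.card F = 2 ∧ IsK A (0 : F) := by
  refine ⟨fun H ↦ ?_, fun ⟨hF, hK⟩ a ↦ ?_⟩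
  · obtain ⟨b, hb⟩ := h
    have hq : ∀ s, n (b + s • 1) = 0 := hn.self_coeff_eq_zero (hn.isTwistedProduct_II ⟨b, hb⟩) H hb
    simp only [hn.norm_add_smul_one] at hq
    have h0 : n b = 0 := by simpa using hq 0
    have h1 : polar n b 1 = -1 := by linear_combination hq 1 - h0
    have hid : ∀ s : F, s * s = s := fun s ↦ by linear_combination hq s - h0 - s * h1
    have h11 : (-1 : F) = 1 := by
      have := hid (-1)
      linear_combination -this
    refine ⟨card_eq_two_of_mul_self hid, isK_of_mul_self hd hb ?_⟩
    rw [hn.mul_self_eq, h0, h1, h11]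
    module
  · obtain ⟨y, hy, -⟩ := hK.exists_mul_self hF a
    rw [hn.mul_self_eq] at hy
    rw [hn.standardMul_II_self]
    refine Submodule.mem_span_singleton.2 ⟨polar n a 1 - 1, ?_⟩
    linear_combination (norm := module) hy

/-- In dimension two, all squares for the product of type IV are multiples of their base exactly
for the algebra `K(1)` over the field with two elements. -/
lemma forall_self_mem_IV_iff (hd : Module.finrank F A = 2)
    (h : ∃ a : A, a ∉ Submodule.span F {(1 : A)}) :
    (∀ a, standardMul n .IV a a ∈ Submodule.span F {a}) ↔ Nat.card F = 2 ∧ IsK A (1 : F) := by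
  refine ⟨fun H ↦ ?_, fun ⟨hF, hK⟩ a ↦ ?_⟩
  · obtain ⟨b, hb4⟩ := hn.exists_four_mul_ne h
    have hb := hn.notMem_span_one hb4
    have hq : ∀ s, polar n (b + s • 1) 1 * polar n (b + s • 1) 1 - n (b + s • 1) = 0 :=
      hn.self_coeff_eq_zero (hn.isTwistedProduct_IV h) H hb
    simp only [hn.norm_add_smul_one, QuadraticMap.polar_add_left, QuadraticMap.polar_smul_left,
      hn.polar_one_one, smul_eq_mul] at hq
    have h0 : n b = polar n b 1 * polar n b 1 := by linear_combination -hq 0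
    -- as `n b = t(b)²`, the nonzero discriminant `4 n(b) - t(b)²` equals `3 t(b)²`
    have h3 : (3 : F) ≠ 0 := fun h3 ↦ hb4 (by linear_combination 4 * h0 + polar n b 1 ^ 2 * h3)
    have h1 : polar n b 1 = -1 := by
      refine mul_left_cancel₀ h3 ?_
      linear_combination hq 1 + h0
    have hid : ∀ s : F, s * s = s := fun s ↦ by
      refine mul_left_cancel₀ h3 ?_
      linear_combination hq s + h0 - 3 * s * h1
    have h11 : (-1 : F) = 1 := by
      have := hid (-1)
      linear_combination -this
    refine ⟨card_eq_two_of_mul_self hid, isK_of_mul_self hd hb ?_⟩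
    rw [hn.mul_self_eq, h0, h1, h11]
    have h2 : (2 : F) = 0 := by linear_combination -h11
    linear_combination (norm := module) -h2 • (1 : A)
  · by_cases ha : a ∈ Submodule.span F {(1 : A)}
    · obtain ⟨c, rfl⟩ := Submodule.mem_span_singleton.1 ha
      refine Submodule.mem_span_singleton.2 ⟨c, ?_⟩
      rw [standardMul_IV_apply, map_smul, hn.conj_one, smul_mul_assoc, one_mul]
    · obtain ⟨y, hy, hy0⟩ := hK.exists_mul_self hF a
      obtain rfl : y = 1 := (eq_zero_or_eq_one_of_card hF y).resolve_left fun h ↦ ha (hy0 h)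
      rw [hn.mul_self_eq] at hy
      have ht : polar n a 1 = 1 := by
        by_contra ht
        refine ha (((Submodule.span F {(1 : A)}).smul_mem_iff (sub_ne_zero.2 ht)).1
          (Submodule.mem_span_singleton.2 ⟨n a + 1, ?_⟩))
        linear_combination (norm := module) -hy
      have hna : n a = -1 := by
        refine smul_left_injective F (one_ne_zero (α := A)) ?_
        rw [ht] at hy
        change n a • (1 : A) = (-1 : F) • (1 : A)
        linear_combination (norm := module) -hy
      have h11 : (-1 : F) = 1 :=
        (eq_zero_or_eq_one_of_card hF _).resolve_left (neg_ne_zero.2 one_ne_zero)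
      rw [hn.standardMul_IV_self, ht, hna, h11]
      exact Submodule.mem_span_singleton.2 ⟨-1, by module⟩

end IsCompositionNorm

end Exceptional

/-! ### Lengths of the standard composition algebras -/

section Lengths

variable {F A : Type*} [Field F] [NonAssocRing A] [Nontrivial A] [Module F A]

lemma ne_top_of_le_span_range {k : ℕ} {v : Fin k → A} {W : Submodule F A}
    (hW : W ≤ Submodule.span F (Set.range v)) (hk : k < Module.finrank F A) : W ≠ ⊤ := by
  rintro rfl
  have := finrank_range_le_card (R := F) v
  rw [Set.finrank, top_unique hW, finrank_top, Fintype.card_fin] at this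
  omega

variable [IsScalarTower F A A] [SMulCommClass F A A] {n : QuadraticForm F A}

lemma lin_mul_pair_one_ne_top {a b : A} (hd : 3 < Module.finrank F A) :
    lin (LinearMap.mul F A) {a, b} 1 ≠ ⊤ := by
  have hs := Submodule.subset_span (R := F) (s := Set.range ![1, a, b])
  refine ne_top_of_le_span_range (v := ![1, a, b]) (lin_mul_one_le (hs ⟨0, rfl⟩) ?_) hd
  rintro z (rfl | rfl)
  · exact hs ⟨1, rfl⟩
  · exact hs ⟨2, rfl⟩

namespace IsTwistedProduct

variable {m : A →ₗ[F] A →ₗ[F] A} {Q : A →ₗ[F] A →ₗ[F] F} {q : A → F}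
  (hm : IsTwistedProduct m Q q) (hn : IsCompositionNorm n)
include hm hn

lemma algLength_eq_two_of_finrank_eq_four (hd : Module.finrank F A = 4)
    (hg : ∃ a u : A, linInfty (LinearMap.mul F A) {a, u} = ⊤) : algLength m = (2 : ℕ) := by
  obtain ⟨a, u, hg⟩ := hg
  have hlow : lin m {a, u} 1 ≠ ⊤ := fun h ↦ by
    refine lin_mul_pair_one_ne_top (F := F) (a := a) (b := u) (by omega) (top_unique ?_)
    rw [← h]
    exact lin_one_le (fun f hf ↦ (hm.not_isUnitElement f hf).elim)
      fun x hx ↦ letter_mem_lin hx le_rfl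
  exact algLength_eq_succ (k := 1)
    (fun S hS ↦ hm.lin_two_eq_top hn hd (top_unique (hS ▸ hm.linInfty_le_linInfty_mul)))
    (linInfty_eq_top_of_lin (hm.lin_two_eq_top hn hd hg)) hlow

end IsTwistedProduct

namespace IsCompositionNorm

variable (hn : IsCompositionNorm n)
include hn

/-- Words of length at most two in three letters span at most the seven dimensions of
`1, a, b, c, ab, ac, bc`. -/
lemma lin_mul_triple_two_ne_top {a b c : A} (hd : 7 < Module.finrank F A) :
    lin (LinearMap.mul F A) {a, b, c} 2 ≠ ⊤ := by
  have hs := Submodule.subset_span (R := F) (s := Set.range ![1, a, b, c, a * b, a * c, b * c])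
  set P := Submodule.span F (Set.range ![1, a, b, c, a * b, a * c, b * c]) with hP
  have h1 : (1 : A) ∈ P := hs ⟨0, rfl⟩
  have ha : a ∈ P := hs ⟨1, rfl⟩
  have hb : b ∈ P := hs ⟨2, rfl⟩
  have hc : c ∈ P := hs ⟨3, rfl⟩
  have hsq : ∀ x ∈ P, x * x ∈ P := fun x hx ↦ by
    rw [hn.mul_self_eq]
    exact sub_mem (P.smul_mem _ hx) (P.smul_mem _ h1)
  have hcomm : ∀ x ∈ P, ∀ y ∈ P, x * y ∈ P → y * x ∈ P := fun x hx y hy hxy ↦ by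
    rw [eq_sub_of_add_eq' (hn.mul_add_mul x y)]
    exact sub_mem (sub_mem (add_mem (P.smul_mem _ hy) (P.smul_mem _ hx)) (P.smul_mem _ h1)) hxy
  have hab : a * b ∈ P := hs ⟨4, rfl⟩
  have hac : a * c ∈ P := hs ⟨5, rfl⟩
  have hbc : b * c ∈ P := hs ⟨6, rfl⟩
  refine ne_top_of_le_span_range (v := ![1, a, b, c, a * b, a * c, b * c])
    (lin_mul_two_le h1 ?_ ?_) hd
  · rintro z (rfl | rfl | rfl) <;> assumption
  · rintro x (rfl | rfl | rfl) y (rfl | rfl | rfl)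
    exacts [hsq _ ha, hab, hac, hcomm _ ha _ hb hab, hsq _ hb, hbc, hcomm _ ha _ hc hac,
      hcomm _ hb _ hc hbc, hsq _ hc]

end IsCompositionNorm

namespace IsTwistedProduct

variable {m : A →ₗ[F] A →ₗ[F] A} {Q : A →ₗ[F] A →ₗ[F] F} {q : A → F}
  (hm : IsTwistedProduct m Q q) (hn : IsCompositionNorm n)
include hm hn

lemma algLength_eq_three_of_finrank_eq_eight (hd : Module.finrank F A = 8)
    (hg : ∃ a u v : A, linInfty (LinearMap.mul F A) {a, u, v} = ⊤) : algLength m = (3 : ℕ) := by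
  obtain ⟨a, u, v, hg⟩ := hg
  have hlow : lin m {a, u, v} 2 ≠ ⊤ := fun h ↦
    hn.lin_mul_triple_two_ne_top (F := F) (a := a) (b := u) (c := v) (by omega)
      (top_unique (h ▸ hm.lin_two_le_lin_mul))
  exact algLength_eq_succ (k := 2)
    (fun S hS ↦ hm.lin_three_eq_top hn hd (top_unique (hS ▸ hm.linInfty_le_linInfty_mul)))
    (linInfty_eq_top_of_lin (hm.lin_three_eq_top hn hd hg)) hlow

end IsTwistedProduct

namespace IsCompositionNorm

lemma algLength_mul_of_finrank_eq_one (hd : Module.finrank F A = 1) :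
    algLength (LinearMap.mul F A) = (0 : ℕ) := by
  refine le_antisymm (algLength_le fun S _ ↦ ?_) (by simp)
  refine top_unique fun x _ ↦ ?_
  obtain ⟨c, rfl⟩ := (finrank_eq_one_iff_of_nonzero' (1 : A) one_ne_zero).1 hd x
  exact Submodule.smul_mem _ _ (one_mem_lin_mul 0)

variable (hn : IsCompositionNorm n)
include hn

lemma standardMul_eq_mul_of_finrank_eq_one (hd : Module.finrank F A = 1) (t : StandardType) :
    standardMul n t = LinearMap.mul F A := by
  have hc : ∀ a, conj n a = a := fun a ↦ by
    obtain ⟨c, rfl⟩ := (finrank_eq_one_iff_of_nonzero' (1 : A) one_ne_zero).1 hd a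
    rw [map_smul, hn.conj_one]
  refine LinearMap.ext₂ fun a b ↦ ?_
  cases t
  · rfl
  · rw [standardMul_II_apply, hc, LinearMap.mul_apply']
  · rw [standardMul_III_apply, hc, LinearMap.mul_apply']
  · rw [standardMul_IV_apply, hc, hc, LinearMap.mul_apply']

lemma algLength_mul_of_finrank_eq_two (hd : Module.finrank F A = 2) :
    algLength (LinearMap.mul F A) = (1 : ℕ) := by
  refine algLength_eq_succ (k := 0) (fun S hS ↦ ?_) linInfty_univ ?_
  · have hfin : FiniteDimensional F A := Module.finite_of_finrank_pos (by omega)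
    rcases hn.lin_one_eq_top_or hS with h | ⟨a, -, b, -, h⟩
    · exact h
    · have := h.fintype_card_le_finrank
      rw [Fintype.card_fin] at this
      omega
  · refine ne_top_of_le_span_range (v := ![1]) (lin_mul_zero_le.trans (Submodule.span_mono ?_))
      (by omega)
    simp

lemma algLength_mul_of_finrank_eq_four (hd : Module.finrank F A = 4)
    (hg : ∃ a u : A, linInfty (LinearMap.mul F A) {a, u} = ⊤) :
    algLength (LinearMap.mul F A) = (2 : ℕ) := by
  obtain ⟨a, u, hg⟩ := hg
  refine algLength_eq_succ (k := 1) (fun S hS ↦ ?_) hg (lin_mul_pair_one_ne_top (by omega))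
  have hfin : FiniteDimensional F A := Module.finite_of_finrank_pos (by omega)
  rcases hn.lin_two_eq_top_or hS with h | ⟨a, -, b, -, c, -, h⟩
  · exact h
  · have := h.fintype_card_le_finrank
    rw [Fintype.card_fin] at this
    omega

lemma algLength_mul_of_finrank_eq_eight (hd : Module.finrank F A = 8)
    (hg : ∃ a u v : A, linInfty (LinearMap.mul F A) {a, u, v} = ⊤) :
    algLength (LinearMap.mul F A) = (3 : ℕ) := by
  obtain ⟨a, u, v, hg⟩ := hg
  refine algLength_eq_succ (k := 2) (fun S hS ↦ ?_) hg (hn.lin_mul_triple_two_ne_top (by omega))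
  rcases hn.lin_two_eq_top_or hS with h | ⟨a, ha, b, hb, c, hc, h⟩
  · exact top_unique (h ▸ lin_mono (by norm_num))
  · have L1 : ∀ {x}, x ∈ S → x ∈ lin (LinearMap.mul F A) S 1 := fun hx ↦ letter_mem_lin hx le_rfl
    have L2 : ∀ {x y}, x ∈ S → y ∈ S → x * y ∈ lin (LinearMap.mul F A) S 2 := fun hx hy ↦
      mul_mem_lin_mul (j := 1) (k := 1) (L1 hx) (L1 hy)
    refine top_unique (span_eq_top_of_linearIndependent (by norm_num) h hd ▸
      Submodule.span_le.2 (Set.range_subset_iff.2 ?_))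
    simp only [Fin.forall_fin_succ, IsEmpty.forall_iff, and_true]
    exact ⟨one_mem_lin_mul 3, lin_mono (by norm_num) (L1 ha), lin_mono (by norm_num) (L1 hb),
      lin_mono (by norm_num) (L1 hc), lin_mono (by norm_num) (L2 ha hb),
      lin_mono (by norm_num) (L2 ha hc), lin_mono (by norm_num) (L2 hb hc),
      mul_mem_lin_mul (j := 1) (k := 2) (L1 ha) (L2 hb hc)⟩

lemma algLength_standardMul_eq_one (hd : Module.finrank F A = 2)
    (h : ∃ a : A, a ∉ Submodule.span F {(1 : A)}) {t : StandardType}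
    (ht : ((t = .II ∨ t = .III) ∧ Nat.card F = 2 ∧ IsK A (0 : F)) ∨
      (t = .IV ∧ Nat.card F = 2 ∧ IsK A (1 : F))) :
    algLength (standardMul n t) = (1 : ℕ) := by
  rcases ht with ⟨rfl | rfl, hK⟩ | ⟨rfl, hK⟩
  · exact algLength_eq_one (hn.not_isUnitElement_II h) hd ((hn.forall_self_mem_II_iff hd h).2 hK)
  · rw [hn.algLength_III]
    exact algLength_eq_one (hn.not_isUnitElement_II h) hd ((hn.forall_self_mem_II_iff hd h).2 hK)
  · exact algLength_eq_one (hn.not_isUnitElement_IV h) hd ((hn.forall_self_mem_IV_iff hd h).2 hK)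

lemma algLength_standardMul_eq_two (hd : Module.finrank F A = 2)
    (h : ∃ a : A, a ∉ Submodule.span F {(1 : A)}) {t : StandardType} (htI : t ≠ .I)
    (ht : ¬ ((t = .II ∨ t = .III) ∧ Nat.card F = 2 ∧ IsK A (0 : F)))
    (ht' : ¬ (t = .IV ∧ Nat.card F = 2 ∧ IsK A (1 : F))) :
    algLength (standardMul n t) = (2 : ℕ) := by
  have hII : ¬ (Nat.card F = 2 ∧ IsK A (0 : F)) → algLength (standardMul n .II) = (2 : ℕ) :=
    fun hK ↦ algLength_eq_two (hn.not_isUnitElement_II h) hd (by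
      rw [← hn.forall_self_mem_II_iff hd h] at hK
      push Not at hK
      exact hK)
  cases t with
  | I => exact (htI rfl).elim
  | II => exact hII fun hK ↦ ht ⟨.inl rfl, hK⟩
  | III =>
    rw [hn.algLength_III]
    exact hII fun hK ↦ ht ⟨.inr rfl, hK⟩
  | IV =>
    refine algLength_eq_two (hn.not_isUnitElement_IV h) hd ?_
    by_contra! hK
    exact ht' ⟨rfl, (hn.forall_self_mem_IV_iff hd h).1 hK⟩

/-- Every standard product of type other than I has the length of some twisted product. -/
lemma exists_isTwistedProduct (h : ∃ a : A, a ∉ Submodule.span F {(1 : A)}) {t : StandardType}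
    (htI : t ≠ .I) : ∃ m Q q, IsTwistedProduct (F := F) (A := A) m Q q ∧
      algLength (standardMul n t) = algLength m := by
  cases t with
  | I => exact (htI rfl).elim
  | II => exact ⟨_, _, _, hn.isTwistedProduct_II h, rfl⟩
  | III => exact ⟨_, _, _, hn.isTwistedProduct_II h, hn.algLength_III⟩
  | IV => exact ⟨_, _, _, hn.isTwistedProduct_IV h, rfl⟩

end IsCompositionNorm

end Lengths

end CompositionAlgebra

open CompositionAlgebra in
theorem theorem3p5 {F A : Type*} [Field F] [NonAssocRing A] [Nontrivial A] [Module F A]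
    [IsScalarTower F A A] [SMulCommClass F A A]
    (n : QuadraticForm F A) (hn : IsCompositionNorm n) (t : StandardType) :
    FiniteDimensional F A ∧
    ∃ l : ℕ, algLength (standardMul n t) = (l : ℕ∞) ∧
      ((t = .I ∨ Module.finrank F A = 1) → (l : ℝ) = Real.logb 2 (Module.finrank F A)) ∧
      ((t = .II ∨ t = .III) → Nat.card F = 2 → IsK A (0 : F) → l = 1) ∧
      (t = .IV → Nat.card F = 2 → IsK A (1 : F) → l = 1) ∧
      (¬ (t = .I ∨ Module.finrank F A = 1) →
        ¬ ((t = .II ∨ t = .III) ∧ Nat.card F = 2 ∧ IsK A (0 : F)) →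
        ¬ (t = .IV ∧ Nat.card F = 2 ∧ IsK A (1 : F)) →
        (l : ℝ) = max 2 (Real.logb 2 (Module.finrank F A))) := by
  have hlog : ∀ k : ℕ, Real.logb 2 ((2 : ℝ) ^ k) = k := fun k ↦ by
    rw [Real.logb_pow, Real.logb_self_eq_one one_lt_two, mul_one]
  have log4 : Real.logb 2 (4 : ℝ) = 2 := by
    rw [show (4 : ℝ) = 2 ^ 2 by norm_num, hlog]
    norm_num
  have log8 : Real.logb 2 (8 : ℝ) = 3 := by
    rw [show (8 : ℝ) = 2 ^ 3 by norm_num, hlog]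
    norm_num
  by_cases h : ∃ a : A, a ∉ Submodule.span F {(1 : A)}
  · obtain ⟨hfin, hd⟩ := hn.hurwitz h
    refine ⟨hfin, ?_⟩
    rcases hd with hd | ⟨hd, hg⟩ | ⟨hd, hg⟩
    · rw [hd]
      by_cases htI : t = .I
      · subst htI
        exact ⟨1, hn.algLength_mul_of_finrank_eq_two hd, by simp, by simp, by simp,
          by simp⟩
      by_cases hex : ((t = .II ∨ t = .III) ∧ Nat.card F = 2 ∧ IsK A (0 : F)) ∨
          (t = .IV ∧ Nat.card F = 2 ∧ IsK A (1 : F))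
      · exact ⟨1, hn.algLength_standardMul_eq_one hd h hex, by simp [htI], by simp, by simp,
          fun _ h1 h2 ↦ (hex.elim h1 h2).elim⟩
      · rw [not_or] at hex
        exact ⟨2, hn.algLength_standardMul_eq_two hd h htI hex.1 hex.2, by simp [htI],
          fun h1 h2 h3 ↦ (hex.1 ⟨h1, h2, h3⟩).elim, fun h1 h2 h3 ↦ (hex.2 ⟨h1, h2, h3⟩).elim,
          by simp⟩
    · have hK : ∀ μ : F, ¬ IsK A μ := fun μ hμ ↦ by
        have := hμ.finrank_eq_two
        omega
      rw [hd]
      by_cases htI : t = .I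
      · subst htI
        exact ⟨2, hn.algLength_mul_of_finrank_eq_four hd hg, by simp [log4], by simp, by simp,
          by simp⟩
      obtain ⟨m, Q, q, hm, hlen⟩ := hn.exists_isTwistedProduct h htI
      exact ⟨2, hlen.trans (hm.algLength_eq_two_of_finrank_eq_four hn hd hg), by simp [htI],
        fun _ _ h ↦ (hK _ h).elim, fun _ _ h ↦ (hK _ h).elim, by simp [log4]⟩
    · have hK : ∀ μ : F, ¬ IsK A μ := fun μ hμ ↦ by
        have := hμ.finrank_eq_two
        omega
      rw [hd]
      by_cases htI : t = .I
      · subst htI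
        exact ⟨3, hn.algLength_mul_of_finrank_eq_eight hd hg, by simp [log8], by simp, by simp,
          by simp⟩
      obtain ⟨m, Q, q, hm, hlen⟩ := hn.exists_isTwistedProduct h htI
      exact ⟨3, hlen.trans (hm.algLength_eq_three_of_finrank_eq_eight hn hd hg), by simp [htI],
        fun _ _ h ↦ (hK _ h).elim, fun _ _ h ↦ (hK _ h).elim, by
          rw [Nat.cast_ofNat, Nat.cast_ofNat, log8]
          norm_num⟩
  · push Not at h
    have hd : Module.finrank F A = 1 :=
      (finrank_eq_one_iff_of_nonzero' (1 : A) one_ne_zero).2 fun w ↦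
        Submodule.mem_span_singleton.1 (h w)
    have hK : ∀ μ : F, ¬ IsK A μ := fun μ hμ ↦ by
      have := hμ.finrank_eq_two
      omega
    refine ⟨Module.finite_of_finrank_pos (by omega), 0, ?_, by simp [hd],
      fun _ _ h ↦ (hK _ h).elim, fun _ _ h ↦ (hK _ h).elim, fun h1 ↦ (h1 (.inr hd)).elim⟩
    rw [hn.standardMul_eq_mul_of_finrank_eq_one hd]
    exact IsCompositionNorm.algLength_mul_of_finrank_eq_one hd
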